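/- Let $(X,\mathscr B,m)$ be an arbitrary probability space and let $L^1(m)$, $L^\infty(m)$ be the real Lebesgue spaces with norm $\|\cdot\|$ on $L^1(m)$. Let $P:L^1(m)\to L^1(m)$ be a Markov operator, i.e. $P$ is linear, $P\varphi\ge 0$ whenever $\varphi\ge 0$, and $\int P\varphi\,dm=\int\varphi\,dm$ for all $\varphi\in L^1(m)$. Let $P^*:L^\infty(m)\to L^\infty(m)$ be its adjoint, determined by $\int P^*\psi\cdot\varphi\,dm=\int\psi\cdot P\varphi\,dm$. Put $D(m)=\{h\in L^1(m): h\ge 0,\ \|h\|=1\}$, $A_n=\frac1n\sum_{i=0}^{n-1}P^i$ for $n\ge1$, and $d(\varphi,F)=\inf_{\psi\in F}\|\varphi-\psi\|$ for $\varnothing\ne F\subset L^1(m)$. The support of $h\in L^1(m)$ is $\operatorname{supp}h=\{h\neq0\}$ (up to an $m$-null set). An invariant density is an $h\in D(m)$ with $Ph=h$. It is ergodic if $\int_A h\,dm\in\{0,1\}$ for every $A\in\mathscr B$ with $P^*1_A\ge 1_A$ $m$-a.e., and it has the maximal support if $\lim_{n\to\infty}(P^*)^n1_{\operatorname{supp}h}=1$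 $m$-a.e. Then the following ten conditions are equivalent. - (MC) There is a nonempty compact set $F\subset L^1(m)$ with $\lim_{n\to\infty}d(A_n\varphi,F)=0$ for all $\varphi\in D(m)$. - (MC2) There are a nonempty compact set $F\subset L^1(m)$ and $\kappa<1$ with $\limsup_{n\to\infty}d(A_n\varphi,F)\le\kappa$ for all $\varphi\in D(m)$. - (WMC) There is a nonempty weakly compact set $F\subset L^1(m)$ with $\lim_{n\to\infty}d(A_n\varphi,F)=0$ for all $\varphi\in D(m)$. - (WMC2) There are a nonempty weakly compact set $F\subset L^1(m)$ and $\kappa<1$ with $\limsup_{n\to\infty}d(A_n\varphi,F)\le\kappa$ for all $\varphi\in D(m)$. - (MCDP) For every $\varepsilon>0$ there is $\delta>0$ such that for every $\varphi\in D(m)$ there is $n_0\ge1$ with $\int_E A_n\varphi\,dm<\varepsilon$ for all $n\ge n_0$ and all $E\in\mathscr B$ with $m(E)<\delta$. - (MCDP2) There are $\kappa<1$ and $\delta>0$ such that for every $\varphi\in D(m)$ there is $n_0\ge1$ with $\int_E A_n\varphi\,dm\le\kappa$ for all $n\ge n_0$ and all $E\in\mathscr B$ with $m(E)<\delta$. -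 (AMC) For every $\varepsilon>0$ there is $\delta>0$ such that $\limsup_{n\to\infty}\int_E A_n\varphi\,dm<\varepsilon$ for all $\varphi\in D(m)$ and all $E\in\mathscr B$ with $m(E)<\delta$. - (AMC2) There are $\kappa<1$ and $\delta>0$ such that $\limsup_{n\to\infty}\int_E A_n\varphi\,dm<\kappa$ for all $\varphi\in D(m)$ and all $E\in\mathscr B$ with $m(E)<\delta$. - (FED) There are $r\ge1$ and ergodic invariant densities $h_1,\dots,h_r$ with mutually disjoint supports (up to an $m$-null set) such that $h=\frac1r(h_1+\dots+h_r)$ has the maximal support. - (APM) There are $r\ge1$, ergodic invariant densities $h_1,\dots,h_r$ with mutually disjoint supports (up to an $m$-null set) and positive bounded linear functionals $\lambda_1,\dots,\lambda_r$ on $L^1(m)$ such that $\lim_{n\to\infty}\big\|A_n\varphi-\sum_{i=1}^r\lambda_i(\varphi)h_i\big\|=0$ for all $\varphi\in L^1(m)$. In particular (MC), (FED) and (APM) are equivalent. -/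

import Mathlib

open MeasureTheory Filter Topology Set
open scoped ENNReal

noncomputable section

/-- A Markov operator on `L¹(m)`: linear, positive and integral preserving. -/
structure MarkovOperator {X : Type*} [MeasurableSpace X] (m : Measure X) extends
    Lp ℝ 1 m →ₗ[ℝ] Lp ℝ 1 m where
  nonneg' : ∀ φ : Lp ℝ 1 m, 0 ≤ φ → 0 ≤ toLinearMap φ
  integral_eq' : ∀ φ : Lp ℝ 1 m, ∫ x, toLinearMap φ x ∂m = ∫ x, φ x ∂m

namespace MarkovOperator

variable {X : Type*} [MeasurableSpace X] {m : Measure X}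

theorem norm_eq_integral_of_nonneg (φ : Lp ℝ 1 m) (h : 0 ≤ φ) : ‖φ‖ = ∫ x, φ x ∂m := by
  rw [L1.norm_eq_integral_norm]
  refine integral_congr_ae ?_
  filter_upwards [(Lp.coeFn_nonneg φ).2 h] with x hx
  exact Real.norm_of_nonneg hx

theorem norm_map_le (P : MarkovOperator m) (φ : Lp ℝ 1 m) : ‖P.toLinearMap φ‖ ≤ ‖φ‖ := by
  have key : |P.toLinearMap φ| ≤ P.toLinearMap |φ| := by
    refine sup_le ?_ ?_
    · have := P.nonneg' (|φ| - φ) (sub_nonneg.2 (le_abs_self φ))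
      rw [map_sub] at this
      exact sub_nonneg.1 this
    · have := P.nonneg' (|φ| + φ) (neg_le_iff_add_nonneg.1 (neg_le_abs φ))
      rw [map_add] at this
      exact neg_le_iff_add_nonneg.2 this
  calc ‖P.toLinearMap φ‖ ≤ ‖P.toLinearMap |φ|‖ := by
        refine norm_le_norm_of_abs_le_abs (key.trans (le_abs_self _))
    _ = ‖|φ|‖ := by
        rw [norm_eq_integral_of_nonneg _ (P.nonneg' _ (abs_nonneg _)), P.integral_eq',
          norm_eq_integral_of_nonneg _ (abs_nonneg _)]
    _ = ‖φ‖ := norm_abs_eq_norm φ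

/-- A Markov operator as a bounded linear operator. -/
def toCLM (P : MarkovOperator m) : Lp ℝ 1 m →L[ℝ] Lp ℝ 1 m :=
  P.toLinearMap.mkContinuous 1 (fun φ => by simpa using P.norm_map_le φ)

@[simp] theorem toCLM_apply (P : MarkovOperator m) (φ : Lp ℝ 1 m) :
    P.toCLM φ = P.toLinearMap φ := rfl

end MarkovOperator

section Duality

variable {X : Type*} [MeasurableSpace X] (m : Measure X)

/-- The duality pairing `⟨ψ, φ⟩ = ∫ ψ φ dm` of `L^∞(m)` with `L¹(m)`. -/
def linftyPairing : Lp ℝ ∞ m →L[ℝ] (Lp ℝ 1 m →L[ℝ] ℝ) :=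
  (ContinuousLinearMap.mul ℝ ℝ).lpPairing m ∞ 1

theorem linftyPairing_apply (ψ : Lp ℝ ∞ m) (φ : Lp ℝ 1 m) :
    linftyPairing m ψ φ = ∫ x, ψ x * φ x ∂m := by
  simpa [linftyPairing] using (ContinuousLinearMap.mul ℝ ℝ).lpPairing_eq_integral ψ φ

variable [IsProbabilityMeasure m]

theorem linftyPairing_indicator (ψ : Lp ℝ ∞ m) {s : Set X} (hs : MeasurableSet s) :
    linftyPairing m ψ (indicatorConstLp 1 hs (measure_ne_top m s) (1 : ℝ)) =
      ∫ x in s, ψ x ∂m := by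
  rw [linftyPairing_apply, ← integral_indicator hs]
  refine integral_congr_ae ?_
  filter_upwards [indicatorConstLp_coeFn (p := 1) (hs := hs) (hμs := measure_ne_top m s)
    (c := (1 : ℝ))] with x hx
  rw [hx]
  by_cases h : x ∈ s <;> simp [h]

theorem linftyPairing_injective : Function.Injective (linftyPairing m) := by
  intro ψ₁ ψ₂ h
  refine Lp.ext (Integrable.ae_eq_of_forall_setIntegral_eq _ _
    (memLp_one_iff_integrable.1 ((Lp.memLp ψ₁).mono_exponent le_top))
    (memLp_one_iff_integrable.1 ((Lp.memLp ψ₂).mono_exponent le_top)) fun s hs _ => ?_)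
  rw [← linftyPairing_indicator m ψ₁ hs, ← linftyPairing_indicator m ψ₂ hs, h]

theorem linftyPairing_surjective : Function.Surjective (linftyPairing m) := by
  intro T
  -- restrict the functional to `L²`, represent it there, and show that the representative is bounded
  let one : Lp ℝ 2 m := indicatorConstLp 2 MeasurableSet.univ (measure_ne_top m _) (1 : ℝ)
  let J : Lp ℝ 2 m →L[ℝ] Lp ℝ 1 m := (ContinuousLinearMap.mul ℝ ℝ).holderL m 2 2 1 one
  have hJ : ∀ f : Lp ℝ 2 m, (J f : X → ℝ) =ᵐ[m] f := by
    intro f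
    have h1 := (ContinuousLinearMap.mul ℝ ℝ).coeFn_holder (r := 1) one f
    filter_upwards [h1, indicatorConstLp_coeFn (p := 2) (hs := MeasurableSet.univ)
      (hμs := measure_ne_top m _) (c := (1 : ℝ))] with x hx hx'
    have hx'' : one x = 1 := hx'.trans (by simp)
    rw [show J f x = _ from hx, hx'']
    simp
  let g : Lp ℝ 2 m := (InnerProductSpace.toDual ℝ (Lp ℝ 2 m)).symm (T.comp J)
  have hgint : Integrable g m :=
    memLp_one_iff_integrable.1 ((Lp.memLp g).mono_exponent (by norm_num))
  have hg : ∀ {s : Set X} (hs : MeasurableSet s),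
      ∫ x in s, g x ∂m = T (indicatorConstLp 1 hs (measure_ne_top m s) (1 : ℝ)) := by
    intro s hs
    have h1 : inner ℝ g (indicatorConstLp 2 hs (measure_ne_top m s) (1 : ℝ)) =
        T (J (indicatorConstLp 2 hs (measure_ne_top m s) (1 : ℝ))) := by
      have := InnerProductSpace.toDual_symm_apply (𝕜 := ℝ)
        (x := indicatorConstLp 2 hs (measure_ne_top m s) (1 : ℝ)) (y := T.comp J)
      exact this
    rw [← L2.inner_indicatorConstLp_one (𝕜 := ℝ) hs (measure_ne_top m s) g, real_inner_comm, h1]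
    congr 1
    refine Lp.ext ?_
    filter_upwards [hJ (indicatorConstLp 2 hs (measure_ne_top m s) (1 : ℝ)),
      indicatorConstLp_coeFn (p := 2) (hs := hs) (hμs := measure_ne_top m s) (c := (1 : ℝ)),
      indicatorConstLp_coeFn (p := 1) (hs := hs) (hμs := measure_ne_top m s) (c := (1 : ℝ))]
      with x h1 h2 h3
    rw [h1, h2, h3]
  have hbound : ∀ {s : Set X}, MeasurableSet s → |∫ x in s, g x ∂m| ≤ ‖T‖ * m.real s := by
    intro s hs
    rw [hg hs, ← Real.norm_eq_abs]
    refine (T.le_opNorm _).trans_eq ?_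
    rw [norm_indicatorConstLp one_ne_zero ENNReal.one_ne_top]
    simp
  have hle : ∀ᵐ x ∂m, g x ≤ ‖T‖ :=
    ae_le_of_forall_setIntegral_le hgint (integrable_const _) fun s hs _ => by
      rw [setIntegral_const, smul_eq_mul, mul_comm]
      exact (abs_le.1 (hbound hs)).2
  have hge : ∀ᵐ x ∂m, -‖T‖ ≤ g x :=
    ae_le_of_forall_setIntegral_le (integrable_const _) hgint fun s hs _ => by
      rw [setIntegral_const, smul_eq_mul, mul_comm, neg_mul]
      exact (abs_le.1 (hbound hs)).1
  have hmem : MemLp g ∞ m := by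
    refine memLp_top_of_bound (Lp.memLp g).1 ‖T‖ ?_
    filter_upwards [hle, hge] with x h1 h2
    exact abs_le.2 ⟨h2, h1⟩
  refine ⟨hmem.toLp, ContinuousLinearMap.ext fun φ => ?_⟩
  have hind : ∀ {s : Set X} (hs : MeasurableSet s),
      linftyPairing m hmem.toLp (indicatorConstLp 1 hs (measure_ne_top m s) (1 : ℝ)) =
        T (indicatorConstLp 1 hs (measure_ne_top m s) (1 : ℝ)) := by
    intro s hs
    rw [linftyPairing_indicator, ← hg hs]
    exact integral_congr_ae (ae_restrict_of_ae hmem.coeFn_toLp)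
  induction φ using Lp.induction ENNReal.one_ne_top with
  | indicatorConst c hs hμs =>
    rename_i s
    have : (Lp.simpleFunc.indicatorConst 1 hs hμs.ne c : Lp ℝ 1 m) =
        c • indicatorConstLp 1 hs (measure_ne_top m s) (1 : ℝ) := by
      rw [Lp.simpleFunc.coe_indicatorConst]
      refine Lp.ext ?_
      filter_upwards [Lp.coeFn_smul c (indicatorConstLp 1 hs (measure_ne_top m s) (1 : ℝ)),
        indicatorConstLp_coeFn (p := 1) (hs := hs) (hμs := measure_ne_top m s) (c := (1 : ℝ)),
        indicatorConstLp_coeFn (p := 1) (hs := hs) (hμs := hμs.ne) (c := c)] with x h1 h2 h3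
      rw [h3, h1, Pi.smul_apply, h2]
      by_cases h : x ∈ s <;> simp [h]
    rw [this, map_smul, map_smul, hind hs]
  | add hf hg' _ h1 h2 => rw [map_add, map_add, h1, h2]
  | isClosed => exact isClosed_eq (ContinuousLinearMap.continuous _) T.continuous

/-- The identification of `L^∞(m)` with the dual of `L¹(m)`, through `ψ ↦ (φ ↦ ∫ ψ φ dm)`. -/
def linftyEquivDual : Lp ℝ ∞ m ≃L[ℝ] (Lp ℝ 1 m →L[ℝ] ℝ) :=
  ContinuousLinearEquiv.ofBijective (linftyPairing m)
    (LinearMap.ker_eq_bot.2 (linftyPairing_injective m))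
    (LinearMap.range_eq_top.2 (linftyPairing_surjective m))

end Duality

namespace MarkovOperator

variable {X : Type*} [MeasurableSpace X] {m : Measure X}

/-- The set `D(m)` of densities. -/
def densities (m : Measure X) : Set (Lp ℝ 1 m) := {h | 0 ≤ h ∧ ‖h‖ = 1}

/-- The Cesàro averages `A_n = (1/n) ∑_{i<n} P^i`; meaningful for `n ≥ 1`. -/
def avg (P : MarkovOperator m) (n : ℕ) : Lp ℝ 1 m →ₗ[ℝ] Lp ℝ 1 m :=
  (n : ℝ)⁻¹ • ∑ i ∈ Finset.range n, P.toLinearMap ^ i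

/-- Weak compactness of a set in `L¹(m)`. -/
def IsWeaklyCompact (F : Set (Lp ℝ 1 m)) : Prop :=
  IsCompact (toWeakSpace ℝ (Lp ℝ 1 m) '' F)

/-! Constrictivity and its variants. Constrictors are required to be non-empty, as the real-valued
`Metric.infDist` to the empty set is `0` by convention. -/

/-- A sequence `(Q_n)` of operators on `L¹(m)` is constrictive: some compact set attracts every
density. -/
def IsConstrictive (Q : ℕ → Lp ℝ 1 m →ₗ[ℝ] Lp ℝ 1 m) : Prop :=
  ∃ F : Set (Lp ℝ 1 m), F.Nonempty ∧ IsCompact F ∧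
    ∀ φ ∈ densities m, Tendsto (fun n : ℕ => Metric.infDist (Q n φ) F) atTop (𝓝 0)

/-- (MC) mean constrictivity -/
def MC (P : MarkovOperator m) : Prop := IsConstrictive P.avg

/-- (MC2) -/
def MC2 (P : MarkovOperator m) : Prop :=
  ∃ F : Set (Lp ℝ 1 m), F.Nonempty ∧ IsCompact F ∧ ∃ κ : ℝ, κ < 1 ∧
    ∀ φ ∈ densities m, limsup (fun n : ℕ => Metric.infDist (P.avg n φ) F) atTop ≤ κ

/-- (WMC) weak mean constrictivity -/
def WMC (P : MarkovOperator m) : Prop :=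
  ∃ F : Set (Lp ℝ 1 m), F.Nonempty ∧ IsWeaklyCompact F ∧
    ∀ φ ∈ densities m, Tendsto (fun n : ℕ => Metric.infDist (P.avg n φ) F) atTop (𝓝 0)

/-- (WMC2) -/
def WMC2 (P : MarkovOperator m) : Prop :=
  ∃ F : Set (Lp ℝ 1 m), F.Nonempty ∧ IsWeaklyCompact F ∧ ∃ κ : ℝ, κ < 1 ∧
    ∀ φ ∈ densities m, limsup (fun n : ℕ => Metric.infDist (P.avg n φ) F) atTop ≤ κ

/-- (MCDP) mean constrictivity à la Dunford–Pettis -/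
def MCDP (P : MarkovOperator m) : Prop :=
  ∀ ε : ℝ, 0 < ε → ∃ δ : ℝ, 0 < δ ∧ ∀ φ ∈ densities m, ∃ n₀ : ℕ, 1 ≤ n₀ ∧
    ∀ n, n₀ ≤ n → ∀ E : Set X, MeasurableSet E → m.real E < δ →
      ∫ x in E, P.avg n φ x ∂m < ε

/-- (MCDP2) -/
def MCDP2 (P : MarkovOperator m) : Prop :=
  ∃ κ : ℝ, κ < 1 ∧ ∃ δ : ℝ, 0 < δ ∧ ∀ φ ∈ densities m, ∃ n₀ : ℕ, 1 ≤ n₀ ∧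
    ∀ n, n₀ ≤ n → ∀ E : Set X, MeasurableSet E → m.real E < δ →
      ∫ x in E, P.avg n φ x ∂m ≤ κ

/-- (AMC) asymptotic mean constrictivity -/
def AMC (P : MarkovOperator m) : Prop :=
  ∀ ε : ℝ, 0 < ε → ∃ δ : ℝ, 0 < δ ∧ ∀ φ ∈ densities m,
    ∀ E : Set X, MeasurableSet E → m.real E < δ →
      limsup (fun n : ℕ => ∫ x in E, P.avg n φ x ∂m) atTop < ε

/-- (AMC2) -/
def AMC2 (P : MarkovOperator m) : Prop :=
  ∃ κ : ℝ, κ < 1 ∧ ∃ δ : ℝ, 0 < δ ∧ ∀ φ ∈ densities m,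
    ∀ E : Set X, MeasurableSet E → m.real E < δ →
      limsup (fun n : ℕ => ∫ x in E, P.avg n φ x ∂m) atTop < κ

/-- The support `{h ≠ 0}` of an integrable function, defined up to a null set. -/
def supp (h : Lp ℝ 1 m) : Set X := {x | h x ≠ 0}

theorem measurableSet_supp (h : Lp ℝ 1 m) : MeasurableSet (supp h) :=
  (Lp.stronglyMeasurable h).measurable (measurableSet_singleton (0 : ℝ)).compl

/-- `P`-invariant densities. -/
def IsInvariantDensity (P : MarkovOperator m) (h : Lp ℝ 1 m) : Prop :=
  h ∈ densities m ∧ P.toLinearMap h = h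

variable [IsProbabilityMeasure m]

/-- The indicator `1_A` as an element of `L^∞(m)`. -/
def ind {A : Set X} (hA : MeasurableSet A) : Lp ℝ ∞ m :=
  indicatorConstLp ∞ hA (measure_ne_top m A) (1 : ℝ)

/-- The adjoint `P^*` on `L^∞(m) ≅ L¹(m)^*`, that is, `ψ ↦ ψ ∘ P` on functionals. -/
def adjoint (P : MarkovOperator m) : Lp ℝ ∞ m →L[ℝ] Lp ℝ ∞ m :=
  (linftyEquivDual m).symm.toContinuousLinearMap ∘L
    (ContinuousLinearMap.precomp ℝ P.toCLM) ∘L (linftyEquivDual m).toContinuousLinearMap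

/-- The duality relation which characterizes the adjoint. -/
theorem integral_adjoint_mul (P : MarkovOperator m) (ψ : Lp ℝ ∞ m) (φ : Lp ℝ 1 m) :
    ∫ x, P.adjoint ψ x * φ x ∂m = ∫ x, ψ x * P.toLinearMap φ x ∂m := by
  rw [← linftyPairing_apply, ← linftyPairing_apply]
  have h : linftyEquivDual m (P.adjoint ψ) = (linftyEquivDual m ψ).comp P.toCLM :=
    (linftyEquivDual m).apply_symm_apply _
  exact congrArg (fun L : Lp ℝ 1 m →L[ℝ] ℝ => L φ) h

/-- An invariant density is ergodic if the probability measure `m_h = h dm` takes only the values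
`0` and `1` on the measurable sets `A` with `P^* 1_A ≥ 1_A`. -/
def IsErgodicDensity (P : MarkovOperator m) (h : Lp ℝ 1 m) : Prop :=
  P.IsInvariantDensity h ∧
    ∀ (A : Set X) (hA : MeasurableSet A), ind hA ≤ P.adjoint (ind hA) →
      ∫ x in A, h x ∂m = 0 ∨ ∫ x in A, h x ∂m = 1

/-- `h` has the maximal support: `lim_n (P^*)^n 1_{supp h} = 1` almost everywhere. -/
def HasMaximalSupport (P : MarkovOperator m) (h : Lp ℝ 1 m) : Prop :=
  ∀ᵐ x ∂m, Tendsto (fun n : ℕ => ((P.adjoint ^ n) (ind (measurableSet_supp h)) : X → ℝ) x)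
    atTop (𝓝 1)

/-- (FED) finitely many ergodic densities -/
def FED (P : MarkovOperator m) : Prop :=
  ∃ (r : ℕ) (h : Fin r → Lp ℝ 1 m), 1 ≤ r ∧ (∀ i, P.IsErgodicDensity (h i)) ∧
    (∀ i j, i ≠ j → m (supp (h i) ∩ supp (h j)) = 0) ∧
    P.HasMaximalSupport ((r : ℝ)⁻¹ • ∑ i, h i)

/-- (APM) asymptotic periodicity in mean -/
def APM (P : MarkovOperator m) : Prop :=
  ∃ (r : ℕ) (h : Fin r → Lp ℝ 1 m) (lam : Fin r → (Lp ℝ 1 m →L[ℝ] ℝ)), 1 ≤ r ∧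
    (∀ i, P.IsErgodicDensity (h i)) ∧
    (∀ i j, i ≠ j → m (supp (h i) ∩ supp (h j)) = 0) ∧
    (∀ i, ∀ φ : Lp ℝ 1 m, 0 ≤ φ → 0 ≤ lam i φ) ∧
    ∀ φ : Lp ℝ 1 m,
      Tendsto (fun n : ℕ => ‖P.avg n φ - ∑ i, lam i φ • h i‖) atTop (𝓝 0)

end MarkovOperator

end

/-!
# Mean constrictive Markov operators

The conditions form a cycle `MC → ⋯ → AMC2 → FED → APM → MC` in which only three links carry weight.

*Weak compactness implies uniform integrability* (`IsWeaklyCompact.exists_integralOn_lt`), which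
leads from the conditions with attracting sets to those with small sets. If uniform integrability
failed, there would be members `f n` of the weakly compact set and disjoint sets `B n` with
`|∫_{B n} f n| ≥ ε`. The compactness of the vectors of masses `(∫_{B n} f)_n` gives a subsequence
along which the integrals over all unions of the `B n` converge, and the Baire category theorem on
the subsets of `ℕ` makes this convergence uniform, as in Schur's theorem.

*AMC2 implies FED* (`fed_of_amc2`). For a density `φ`, truncate the averages, `A_n φ ⊓ k`, take the
weak limit along an ultrafilter, and let `k → ∞`. The resulting function `g` satisfies `P g ≤ g`,
hence `P g = g` as `P` preserves the integral (`exists_invariant_truncated_limit`). It can vanish on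
a set `T` only if the averages tend to `0` in measure on `T` along the ultrafilter, and then a union
of small sets on which their mass concentrates contradicts AMC2
(`exists_invariant_of_le_integralOn_avg`). By AMC2 the support of an invariant density has measure
at least `δ`, so that there is a maximal finite family of invariant densities with disjoint
supports. Maximality makes its members ergodic. Suppose that mass persists off the union `S` of
the supports. A late iterate conditioned on the complement of `S` keeps almost all of its mass there
(`exists_density_le_integralOn_compl_pow`), and the limit construction applied to it yields one more
invariant density, off `S`.

*FED implies APM* (`meanConvergent_span_eq_top`). The averages of a function dominated by a multiple
of an invariant density stay in an order interval, which is weakly compact, so that they converge in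
norm by Yosida's mean ergodic theorem (`tendsto_avg_of_weak_tendsto`). An ergodic density is the
only invariant density on its support (`IsErgodicDensity.eq_norm_smul`), so that the limit is a
combination of the `h_i`. Such functions are dense among those carried by the union `S` of the
supports. Since `S` attracts all mass, `P^N φ` is nearly carried by `S` for large `N`, and `φ` and
`P^N φ` have the same asymptotic averages.

A set `A` with `1_A ≤ P^* 1_A` is called absorbing below; by duality this means that `P` moves no
mass out of `A` (`ind_le_adjoint_ind_iff`).
-/

/-! ### The ordered Banach space `L¹(m)` -/

section OrderedLOne

variable {X : Type*} [MeasurableSpace X] {m : Measure X}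

instance Lp.instIsOrderedModuleReal : IsOrderedModule ℝ (Lp ℝ 1 m) :=
  IsOrderedModule.of_smul_nonneg fun c hc φ hφ => by
    rw [← Lp.coeFn_nonneg] at hφ ⊢
    filter_upwards [hφ, Lp.coeFn_smul c φ] with x hx h
    rw [h]
    exact mul_nonneg hc hx

/-- The norm of `L¹` is additive on the positive cone. -/
theorem Lp.norm_add_of_nonneg {φ ψ : Lp ℝ 1 m} (hφ : 0 ≤ φ) (hψ : 0 ≤ ψ) :
    ‖φ + ψ‖ = ‖φ‖ + ‖ψ‖ := by
  rw [MarkovOperator.norm_eq_integral_of_nonneg _ hφ,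
    MarkovOperator.norm_eq_integral_of_nonneg _ hψ,
    MarkovOperator.norm_eq_integral_of_nonneg _ (add_nonneg hφ hψ),
    ← integral_add (L1.integrable_coeFn φ) (L1.integrable_coeFn ψ)]
  exact integral_congr_ae (Lp.coeFn_add φ ψ)

theorem Lp.norm_sub_of_le {φ ψ : Lp ℝ 1 m} (hφ : 0 ≤ φ) (h : φ ≤ ψ) :
    ‖ψ - φ‖ = ‖ψ‖ - ‖φ‖ := by
  have := Lp.norm_add_of_nonneg (sub_nonneg.2 h) hφ
  rw [sub_add_cancel] at this
  linarith

theorem Lp.norm_le_of_le {φ ψ : Lp ℝ 1 m} (hφ : 0 ≤ φ) (h : φ ≤ ψ) : ‖φ‖ ≤ ‖ψ‖ := by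
  have := Lp.norm_sub_of_le hφ h
  linarith [norm_nonneg (ψ - φ)]

theorem Lp.eq_of_le_of_norm_le {φ ψ : Lp ℝ 1 m} (hφ : 0 ≤ φ) (h : φ ≤ ψ) (hn : ‖ψ‖ ≤ ‖φ‖) :
    φ = ψ := by
  have := Lp.norm_sub_of_le hφ h
  have h0 : ‖ψ - φ‖ = 0 := le_antisymm (by linarith) (norm_nonneg _)
  exact (sub_eq_zero.1 (norm_eq_zero.1 h0)).symm

theorem Lp.norm_smul_of_nonneg {c : ℝ} (hc : 0 ≤ c) (φ : Lp ℝ 1 m) : ‖c • φ‖ = c * ‖φ‖ := by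
  rw [norm_smul, Real.norm_of_nonneg hc]

theorem inv_norm_smul_mem_densities {φ : Lp ℝ 1 m} (hφ : 0 ≤ φ) (h0 : φ ≠ 0) :
    ‖φ‖⁻¹ • φ ∈ MarkovOperator.densities m := by
  refine ⟨smul_nonneg (by positivity) hφ, ?_⟩
  rw [Lp.norm_smul_of_nonneg (by positivity), inv_mul_cancel₀ (norm_ne_zero_iff.2 h0)]

/-- Lattice form of `(φ - c)⁺ ≤ (ψ - c)⁺`. -/
theorem sub_inf_le_sub_inf {α : Type*} [Lattice α] [AddCommGroup α] [IsOrderedAddMonoid α]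
    {φ ψ : α} (c : α) (h : φ ≤ ψ) : φ - φ ⊓ c ≤ ψ - ψ ⊓ c := by
  rw [sub_inf, sub_inf, sub_self, sub_self]
  exact sup_le_sup le_rfl (sub_le_sub_right h c)

/-- Truncation by multiples of `h` exhausts every positive function that vanishes off `supp h`. -/
theorem Lp.tendsto_inf_nat_smul {φ h : Lp ℝ 1 m} (hφ : 0 ≤ φ) (hh : 0 ≤ h)
    (hsupp : ∀ᵐ x ∂m, h x = 0 → φ x = 0) :
    Tendsto (fun k : ℕ => φ ⊓ (k : ℝ) • h) atTop (𝓝 φ) := by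
  have hnn : ∀ k : ℕ, 0 ≤ φ ⊓ (k : ℝ) • h := fun k => le_inf hφ (smul_nonneg k.cast_nonneg hh)
  have hco : ∀ k : ℕ, (φ ⊓ (k : ℝ) • h : Lp ℝ 1 m) =ᵐ[m] fun x => φ x ⊓ k * h x := fun k => by
    filter_upwards [Lp.coeFn_inf φ ((k : ℝ) • h), Lp.coeFn_smul (k : ℝ) h] with x h1 h2
    rw [h1, Pi.inf_apply, h2, Pi.smul_apply, smul_eq_mul]
  have hφ' := (Lp.coeFn_nonneg _).2 hφ
  have hh' := (Lp.coeFn_nonneg _).2 hh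
  have key : Tendsto (fun k : ℕ => ∫ x, (φ ⊓ (k : ℝ) • h : Lp ℝ 1 m) x ∂m) atTop
      (𝓝 (∫ x, φ x ∂m)) := by
    refine tendsto_integral_of_dominated_convergence (fun x => φ x)
      (fun k => (Lp.stronglyMeasurable _).aestronglyMeasurable) (L1.integrable_coeFn φ) ?_ ?_
    · intro k
      filter_upwards [hco k, hφ', hh'] with x h1 h2 h3
      have h2 : 0 ≤ φ x := h2
      have h3 : 0 ≤ h x := h3
      rw [h1, Real.norm_of_nonneg (le_inf h2 (by positivity))]
      exact inf_le_left
    · filter_upwards [ae_all_iff.2 hco, hφ', hh', hsupp] with x h1 h2 h3 h4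
      refine tendsto_const_nhds.congr' ?_
      rcases eq_or_ne (h x) 0 with h0 | h0
      · filter_upwards with k
        rw [h1, h0, h4 h0]
        simp
      · have hpos : 0 < h x := lt_of_le_of_ne h3 h0.symm
        obtain ⟨N, hN⟩ := exists_nat_ge (φ x / h x)
        filter_upwards [eventually_ge_atTop N] with k hk
        rw [h1, eq_comm, inf_eq_left]
        rw [div_le_iff₀ hpos] at hN
        refine hN.trans ?_
        gcongr
  rw [tendsto_iff_norm_sub_tendsto_zero]
  have : (fun k : ℕ => ‖φ ⊓ (k : ℝ) • h - φ‖) =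
      fun k : ℕ => (∫ x, φ x ∂m) - ∫ x, (φ ⊓ (k : ℝ) • h : Lp ℝ 1 m) x ∂m := by
    funext k
    rw [norm_sub_rev, Lp.norm_sub_of_le (hnn k) inf_le_left,
      MarkovOperator.norm_eq_integral_of_nonneg _ hφ,
      MarkovOperator.norm_eq_integral_of_nonneg _ (hnn k)]
  rw [this]
  simpa using (tendsto_const_nhds (x := ∫ x, φ x ∂m)).sub key

/-- A positive, increasing and norm bounded sequence in `L¹` converges in norm. -/
theorem Lp.exists_tendsto_of_monotone {v : ℕ → Lp ℝ 1 m} (hv : Monotone v) (h0 : 0 ≤ v 0)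
    {C : ℝ} (hC : ∀ k, ‖v k‖ ≤ C) : ∃ g, Tendsto v atTop (𝓝 g) ∧ ∀ k, v k ≤ g := by
  have hnn : ∀ k, 0 ≤ v k := fun k => h0.trans (hv k.zero_le)
  have hmono : Monotone fun k => ‖v k‖ := fun i j hij => Lp.norm_le_of_le (hnn i) (hv hij)
  have hlim := tendsto_atTop_ciSup hmono ⟨C, by rintro _ ⟨k, rfl⟩; exact hC k⟩
  have hcau : CauchySeq v := by
    have := hlim.cauchySeq
    rw [Metric.cauchySeq_iff'] at this ⊢
    intro ε hε
    obtain ⟨N, hN⟩ := this ε hε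
    refine ⟨N, fun n hn => ?_⟩
    have h1 := hN n hn
    rw [dist_eq_norm, Lp.norm_sub_of_le (hnn N) (hv hn)]
    rw [Real.dist_eq] at h1
    exact (le_abs_self _).trans_lt h1
  obtain ⟨g, hg⟩ := cauchySeq_tendsto_of_complete hcau
  exact ⟨g, hg, fun k => hv.ge_of_tendsto hg k⟩

end OrderedLOne

/-! ### Integration over a set and restriction to a set -/

namespace MarkovOperator

section Restriction

variable {X : Type*} [MeasurableSpace X] {m : Measure X} [IsProbabilityMeasure m]

/-- The bounded functional `φ ↦ ∫_A φ dm` on `L¹(m)`. -/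
noncomputable def integralOn {A : Set X} (hA : MeasurableSet A) : Lp ℝ 1 m →L[ℝ] ℝ :=
  linftyPairing m (ind hA)

/-- The restriction `φ ↦ 1_A φ` as a bounded operator on `L¹(m)`. -/
noncomputable def restr {A : Set X} (hA : MeasurableSet A) : Lp ℝ 1 m →L[ℝ] Lp ℝ 1 m :=
  (ContinuousLinearMap.mul ℝ ℝ).holderL m ∞ 1 1 (ind hA)

variable {A : Set X} (hA : MeasurableSet A)

theorem coeFn_ind : (ind hA : Lp ℝ ∞ m) =ᵐ[m] A.indicator fun _ => (1 : ℝ) :=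
  indicatorConstLp_coeFn

theorem coeFn_restr (φ : Lp ℝ 1 m) : (restr hA φ : X → ℝ) =ᵐ[m] A.indicator φ := by
  have h := (ContinuousLinearMap.mul ℝ ℝ).coeFn_holder (r := 1) (ind hA : Lp ℝ ∞ m) φ
  filter_upwards [h, coeFn_ind (m := m) hA] with x h1 h2
  rw [show restr hA φ x = _ from h1, h2]
  by_cases hx : x ∈ A <;> simp [hx]

theorem integralOn_apply (φ : Lp ℝ 1 m) : integralOn hA φ = ∫ x in A, φ x ∂m := by
  rw [integralOn, linftyPairing_apply, ← integral_indicator hA]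
  refine integral_congr_ae ?_
  filter_upwards [coeFn_ind (m := m) hA] with x h
  rw [h]
  by_cases hx : x ∈ A <;> simp [hx]

theorem le_of_integralOn_le {φ ψ : Lp ℝ 1 m}
    (h : ∀ (A : Set X) (hA : MeasurableSet A), integralOn hA φ ≤ integralOn hA ψ) : φ ≤ ψ := by
  rw [← Lp.coeFn_le]
  refine ae_le_of_forall_setIntegral_le (L1.integrable_coeFn φ) (L1.integrable_coeFn ψ) ?_
  intro s hs _
  simpa [integralOn_apply] using h s hs

theorem integralOn_mono {φ ψ : Lp ℝ 1 m} (h : φ ≤ ψ) : integralOn hA φ ≤ integralOn hA ψ := by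
  rw [integralOn_apply, integralOn_apply]
  exact setIntegral_mono_ae (L1.integrable_coeFn φ).integrableOn
    (L1.integrable_coeFn ψ).integrableOn
    ((Lp.coeFn_le φ ψ).2 h)

theorem integralOn_nonneg {φ : Lp ℝ 1 m} (h : 0 ≤ φ) : 0 ≤ integralOn hA φ := by
  simpa using integralOn_mono hA h

theorem norm_eq_integralOn_univ {φ : Lp ℝ 1 m} (h : 0 ≤ φ) :
    ‖φ‖ = integralOn MeasurableSet.univ φ := by
  rw [integralOn_apply, norm_eq_integral_of_nonneg _ h, setIntegral_univ]

theorem restr_nonneg {φ : Lp ℝ 1 m} (h : 0 ≤ φ) : 0 ≤ restr hA φ := by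
  rw [← Lp.coeFn_nonneg] at h ⊢
  filter_upwards [h, coeFn_restr hA φ] with x h1 h2
  rw [h2]
  exact indicator_apply_nonneg fun _ => h1

theorem restr_mono {φ ψ : Lp ℝ 1 m} (h : φ ≤ ψ) : restr hA φ ≤ restr hA ψ := by
  have := restr_nonneg hA (sub_nonneg.2 h)
  rwa [map_sub, sub_nonneg] at this

theorem restr_add_restr_compl (φ : Lp ℝ 1 m) : restr hA φ + restr hA.compl φ = φ := by
  refine Lp.ext ?_
  filter_upwards [Lp.coeFn_add (restr hA φ) (restr hA.compl φ), coeFn_restr hA φ,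
    coeFn_restr hA.compl φ] with x h1 h2 h3
  rw [h1, Pi.add_apply, h2, h3]
  by_cases hx : x ∈ A <;> simp [hx]

theorem restr_le {φ : Lp ℝ 1 m} (h : 0 ≤ φ) : restr hA φ ≤ φ := by
  conv_rhs => rw [← restr_add_restr_compl hA φ]
  exact le_add_of_nonneg_right (restr_nonneg _ h)

theorem integralOn_eq_norm_restr {φ : Lp ℝ 1 m} (h : 0 ≤ φ) :
    integralOn hA φ = ‖restr hA φ‖ := by
  rw [norm_eq_integral_of_nonneg _ (restr_nonneg hA h), integralOn_apply, ← integral_indicator hA]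
  exact integral_congr_ae (coeFn_restr hA φ).symm

theorem norm_eq_integralOn_add_compl {φ : Lp ℝ 1 m} (h : 0 ≤ φ) :
    ‖φ‖ = integralOn hA φ + integralOn hA.compl φ := by
  rw [integralOn_eq_norm_restr _ h, integralOn_eq_norm_restr _ h,
    ← Lp.norm_add_of_nonneg (restr_nonneg _ h) (restr_nonneg _ h), restr_add_restr_compl]

theorem integralOn_le_norm {φ : Lp ℝ 1 m} (h : 0 ≤ φ) : integralOn hA φ ≤ ‖φ‖ := by
  rw [norm_eq_integralOn_add_compl hA h]
  exact le_add_of_nonneg_right (integralOn_nonneg _ h)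

theorem abs_integralOn_le (φ : Lp ℝ 1 m) : |integralOn hA φ| ≤ ‖φ‖ := by
  rw [abs_le]
  have h1 := integralOn_mono hA (le_abs_self φ)
  have h2 := integralOn_mono hA (neg_le_abs φ)
  have h3 := integralOn_le_norm hA (abs_nonneg φ)
  rw [norm_abs_eq_norm] at h3
  rw [map_neg] at h2
  constructor <;> linarith

theorem restr_eq_self_iff {φ : Lp ℝ 1 m} :
    restr hA φ = φ ↔ ∀ᵐ x ∂m, x ∉ A → φ x = 0 := by
  constructor
  · intro h
    filter_upwards [coeFn_restr hA φ] with x hx hxA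
    rw [h] at hx
    rw [hx, indicator_of_notMem hxA]
  · intro h
    refine Lp.ext ?_
    filter_upwards [coeFn_restr hA φ, h] with x hx h2
    rw [hx]
    by_cases hxA : x ∈ A
    · rw [indicator_of_mem hxA]
    · rw [indicator_of_notMem hxA, h2 hxA]

/-- A positive function all of whose mass lies in `A` vanishes off `A`. -/
theorem restr_eq_self_of_norm_le {φ : Lp ℝ 1 m} (h : 0 ≤ φ) (hn : ‖φ‖ ≤ integralOn hA φ) :
    restr hA φ = φ :=
  Lp.eq_of_le_of_norm_le (restr_nonneg hA h) (restr_le hA h)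
    (by rwa [← integralOn_eq_norm_restr hA h])

theorem integralOn_of_restr_eq_self {φ : Lp ℝ 1 m} (h : 0 ≤ φ) (hr : restr hA φ = φ) :
    integralOn hA φ = ‖φ‖ := by
  rw [integralOn_eq_norm_restr hA h, hr]

theorem restr_restr (φ : Lp ℝ 1 m) : restr hA (restr hA φ) = restr hA φ := by
  rw [restr_eq_self_iff]
  filter_upwards [coeFn_restr hA φ] with x hx hxA
  rw [hx, indicator_of_notMem hxA]

/-- The constant function `1` in `L¹(m)`. -/
noncomputable def oneLp (m : Measure X) [IsProbabilityMeasure m] : Lp ℝ 1 m := Lp.const 1 m (1 : ℝ)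

theorem coeFn_oneLp : (oneLp m : X → ℝ) =ᵐ[m] fun _ => 1 := Lp.coeFn_const _ _ _

theorem oneLp_mem_densities : oneLp m ∈ densities m := by
  constructor
  · rw [← Lp.coeFn_nonneg]
    filter_upwards [coeFn_oneLp (m := m)] with x hx
    rw [hx]
    exact zero_le_one
  · rw [oneLp, Lp.norm_const' _ _ _ one_ne_zero ENNReal.one_ne_top]
    simp

theorem oneLp_nonneg : 0 ≤ oneLp m := oneLp_mem_densities.1

theorem tendsto_inf_nat_smul_oneLp {φ : Lp ℝ 1 m} (hφ : 0 ≤ φ) :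
    Tendsto (fun k : ℕ => φ ⊓ (k : ℝ) • oneLp m) atTop (𝓝 φ) := by
  refine Lp.tendsto_inf_nat_smul hφ oneLp_nonneg ?_
  filter_upwards [coeFn_oneLp (m := m)] with x hx h
  rw [hx] at h
  exact absurd h one_ne_zero

end Restriction

end MarkovOperator

/-! ### Markov operators, their iterates and their Cesàro averages -/

namespace MarkovOperator

section Averages

variable {X : Type*} [MeasurableSpace X] {m : Measure X} (P : MarkovOperator m)

theorem map_mono {φ ψ : Lp ℝ 1 m} (h : φ ≤ ψ) : P.toLinearMap φ ≤ P.toLinearMap ψ := by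
  have := P.nonneg' _ (sub_nonneg.2 h)
  rwa [map_sub, sub_nonneg] at this

theorem norm_map_of_nonneg {φ : Lp ℝ 1 m} (h : 0 ≤ φ) : ‖P.toLinearMap φ‖ = ‖φ‖ := by
  rw [norm_eq_integral_of_nonneg _ h, norm_eq_integral_of_nonneg _ (P.nonneg' _ h),
    P.integral_eq']

theorem map_eq_of_map_le {φ : Lp ℝ 1 m} (h : 0 ≤ φ) (hle : P.toLinearMap φ ≤ φ) :
    P.toLinearMap φ = φ :=
  Lp.eq_of_le_of_norm_le (P.nonneg' _ h) hle (P.norm_map_of_nonneg h).ge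

theorem pow_succ_apply (n : ℕ) (φ : Lp ℝ 1 m) :
    (P.toLinearMap ^ (n + 1)) φ = P.toLinearMap ((P.toLinearMap ^ n) φ) := by
  rw [pow_succ', Module.End.mul_apply]

theorem pow_succ_apply' (n : ℕ) (φ : Lp ℝ 1 m) :
    (P.toLinearMap ^ (n + 1)) φ = (P.toLinearMap ^ n) (P.toLinearMap φ) := by
  rw [pow_succ, Module.End.mul_apply]

theorem pow_nonneg {φ : Lp ℝ 1 m} (h : 0 ≤ φ) (n : ℕ) : 0 ≤ (P.toLinearMap ^ n) φ := by
  induction n with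
  | zero => simpa using h
  | succ n ih => rw [pow_succ_apply]; exact P.nonneg' _ ih

theorem norm_pow_le (φ : Lp ℝ 1 m) (n : ℕ) : ‖(P.toLinearMap ^ n) φ‖ ≤ ‖φ‖ := by
  induction n with
  | zero => simp
  | succ n ih => rw [pow_succ_apply]; exact (P.norm_map_le _).trans ih

theorem norm_pow_of_nonneg {φ : Lp ℝ 1 m} (h : 0 ≤ φ) (n : ℕ) :
    ‖(P.toLinearMap ^ n) φ‖ = ‖φ‖ := by
  induction n with
  | zero => simp
  | succ n ih => rw [pow_succ_apply, P.norm_map_of_nonneg (P.pow_nonneg h n), ih]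

theorem pow_apply_of_map_eq {φ : Lp ℝ 1 m} (h : P.toLinearMap φ = φ) (n : ℕ) :
    (P.toLinearMap ^ n) φ = φ := by
  induction n with
  | zero => simp
  | succ n ih => rw [pow_succ_apply, ih, h]

theorem avg_apply (n : ℕ) (φ : Lp ℝ 1 m) :
    P.avg n φ = (n : ℝ)⁻¹ • ∑ i ∈ Finset.range n, (P.toLinearMap ^ i) φ := by
  simp [avg]

theorem avg_nonneg {φ : Lp ℝ 1 m} (h : 0 ≤ φ) (n : ℕ) : 0 ≤ P.avg n φ := by
  rw [avg_apply]
  exact smul_nonneg (by positivity) (Finset.sum_nonneg fun i _ => P.pow_nonneg h i)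

theorem avg_mono {φ ψ : Lp ℝ 1 m} (h : φ ≤ ψ) (n : ℕ) : P.avg n φ ≤ P.avg n ψ := by
  have := P.avg_nonneg (sub_nonneg.2 h) n
  rwa [map_sub, sub_nonneg] at this

/-- The average of a constant over `Finset.range n` recovers the constant. -/
theorem inv_mul_sum_const {n : ℕ} (hn : 1 ≤ n) (c : ℝ) :
    (n : ℝ)⁻¹ * ∑ _i ∈ Finset.range n, c = c := by
  have : (n : ℝ) ≠ 0 := by positivity
  rw [Finset.sum_const, Finset.card_range, nsmul_eq_mul]
  field_simp

theorem norm_avg_le (φ : Lp ℝ 1 m) (n : ℕ) : ‖P.avg n φ‖ ≤ ‖φ‖ := by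
  rcases Nat.eq_zero_or_pos n with rfl | hn
  · simp [avg_apply]
  · rw [avg_apply, Lp.norm_smul_of_nonneg (by positivity), ← inv_mul_sum_const hn ‖φ‖]
    gcongr
    exact norm_sum_le_of_le _ fun i _ => P.norm_pow_le φ i

theorem apply_avg (l : Lp ℝ 1 m →L[ℝ] ℝ) (n : ℕ) (φ : Lp ℝ 1 m) :
    l (P.avg n φ) = (n : ℝ)⁻¹ * ∑ i ∈ Finset.range n, l ((P.toLinearMap ^ i) φ) := by
  rw [avg_apply, map_smul, map_sum, smul_eq_mul]

theorem avg_of_map_eq {φ : Lp ℝ 1 m} (h : P.toLinearMap φ = φ) {n : ℕ} (hn : 1 ≤ n) :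
    P.avg n φ = φ := by
  have : (n : ℝ) ≠ 0 := by positivity
  rw [avg_apply, Finset.sum_congr rfl fun i _ => P.pow_apply_of_map_eq h i, Finset.sum_const,
    Finset.card_range, ← Nat.cast_smul_eq_nsmul ℝ, smul_smul, inv_mul_cancel₀ this, one_smul]

theorem avg_sub_map (n : ℕ) (φ : Lp ℝ 1 m) :
    P.avg n (φ - P.toLinearMap φ) = (n : ℝ)⁻¹ • (φ - (P.toLinearMap ^ n) φ) := by
  rw [avg_apply]
  congr 1
  rw [← neg_sub ((P.toLinearMap ^ n) φ) φ]
  have := Finset.sum_range_sub (fun i => (P.toLinearMap ^ i) φ) n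
  rw [pow_zero, Module.End.one_apply] at this
  rw [← this, ← Finset.sum_neg_distrib]
  refine Finset.sum_congr rfl fun i _ => ?_
  rw [map_sub, pow_succ_apply', neg_sub]

theorem tendsto_avg_sub_map (φ : Lp ℝ 1 m) :
    Tendsto (fun n => P.avg n (φ - P.toLinearMap φ)) atTop (𝓝 0) := by
  have h : Tendsto (fun n : ℕ => (n : ℝ)⁻¹ * (2 * ‖φ‖)) atTop (𝓝 0) := by
    simpa using (tendsto_inv_atTop_nhds_zero_nat (𝕜 := ℝ)).mul_const (2 * ‖φ‖)
  refine squeeze_zero_norm (fun n => ?_) h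
  rw [avg_sub_map, Lp.norm_smul_of_nonneg (by positivity)]
  gcongr
  refine (norm_sub_le _ _).trans ?_
  linarith [P.norm_pow_le φ n]

theorem map_avg (n : ℕ) (φ : Lp ℝ 1 m) :
    P.toLinearMap (P.avg n φ) = P.avg n (P.toLinearMap φ) := by
  rw [avg_apply, avg_apply, map_smul, map_sum]
  congr 1
  refine Finset.sum_congr rfl fun i _ => ?_
  rw [← pow_succ_apply, pow_succ_apply']

theorem tendsto_avg_sub_map_avg (φ : Lp ℝ 1 m) :
    Tendsto (fun n => P.avg n φ - P.toLinearMap (P.avg n φ)) atTop (𝓝 0) := by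
  refine (P.tendsto_avg_sub_map φ).congr fun n => ?_
  rw [map_sub, map_avg]

/-- The positive part of an invariant function is invariant. -/
theorem map_sup_zero_of_map_eq {φ : Lp ℝ 1 m} (h : P.toLinearMap φ = φ) :
    P.toLinearMap (φ ⊔ 0) = φ ⊔ 0 := by
  have h0 : (0 : Lp ℝ 1 m) ≤ φ ⊔ 0 := le_sup_right
  have hle : φ ⊔ 0 ≤ P.toLinearMap (φ ⊔ 0) := by
    refine sup_le ?_ (P.nonneg' _ h0)
    conv_lhs => rw [← h]
    exact P.map_mono le_sup_left
  exact (Lp.eq_of_le_of_norm_le h0 hle (P.norm_map_of_nonneg h0).le).symm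

end Averages

/-! ### Absorbing sets -/

section Absorbing

variable {X : Type*} [MeasurableSpace X] {m : Measure X}

theorem linftyPairing_nonneg {ψ : Lp ℝ ∞ m} {φ : Lp ℝ 1 m} (hψ : 0 ≤ ψ) (hφ : 0 ≤ φ) :
    0 ≤ linftyPairing m ψ φ := by
  rw [linftyPairing_apply]
  refine integral_nonneg_of_ae ?_
  filter_upwards [(Lp.coeFn_nonneg _).2 hψ, (Lp.coeFn_nonneg _).2 hφ] with x h1 h2
  exact mul_nonneg h1 h2

variable [IsProbabilityMeasure m] (P : MarkovOperator m)

theorem le_of_linftyPairing_le {ψ₁ ψ₂ : Lp ℝ ∞ m}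
    (h : ∀ φ : Lp ℝ 1 m, 0 ≤ φ → linftyPairing m ψ₁ φ ≤ linftyPairing m ψ₂ φ) : ψ₁ ≤ ψ₂ := by
  rw [← Lp.coeFn_le]
  refine ae_le_of_forall_setIntegral_le
    (memLp_one_iff_integrable.1 ((Lp.memLp ψ₁).mono_exponent le_top))
    (memLp_one_iff_integrable.1 ((Lp.memLp ψ₂).mono_exponent le_top)) fun s hs _ => ?_
  rw [← linftyPairing_indicator m ψ₁ hs, ← linftyPairing_indicator m ψ₂ hs]
  refine h _ ?_
  rw [← Lp.coeFn_nonneg]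
  filter_upwards [indicatorConstLp_coeFn (p := 1) (hs := hs) (hμs := measure_ne_top m s)
    (c := (1 : ℝ))] with x hx
  rw [hx]
  exact indicator_apply_nonneg fun _ => zero_le_one

theorem linftyPairing_adjoint (ψ : Lp ℝ ∞ m) (φ : Lp ℝ 1 m) :
    linftyPairing m (P.adjoint ψ) φ = linftyPairing m ψ (P.toLinearMap φ) := by
  rw [linftyPairing_apply, linftyPairing_apply, P.integral_adjoint_mul]

theorem linftyPairing_adjoint_pow (n : ℕ) (ψ : Lp ℝ ∞ m) (φ : Lp ℝ 1 m) :
    linftyPairing m ((P.adjoint ^ n) ψ) φ = linftyPairing m ψ ((P.toLinearMap ^ n) φ) := by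
  induction n generalizing φ with
  | zero => simp
  | succ n ih =>
    rw [pow_succ', mul_apply_eq_comp, linftyPairing_adjoint, ih, pow_succ_apply']

variable {A : Set X} (hA : MeasurableSet A)

/-- Dual description of the absorbing sets: `1_A ≤ P^* 1_A` says that `P` does not move mass out
of `A`. -/
theorem ind_le_adjoint_ind_iff : ind hA ≤ P.adjoint (ind hA) ↔
    ∀ φ : Lp ℝ 1 m, 0 ≤ φ → integralOn hA φ ≤ integralOn hA (P.toLinearMap φ) := by
  constructor
  · intro h φ hφ
    have := linftyPairing_nonneg (sub_nonneg.2 h) hφ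
    rwa [map_sub, sub_apply, linftyPairing_adjoint, sub_nonneg] at this
  · intro h
    refine le_of_linftyPairing_le fun φ hφ => ?_
    rw [linftyPairing_adjoint]
    exact h φ hφ

variable {P} {hA}

theorem restr_map_eq_of_absorbing (h : ind hA ≤ P.adjoint (ind hA)) {φ : Lp ℝ 1 m} (hφ : 0 ≤ φ)
    (hr : restr hA φ = φ) : restr hA (P.toLinearMap φ) = P.toLinearMap φ := by
  refine restr_eq_self_of_norm_le hA (P.nonneg' _ hφ) ?_
  rw [P.norm_map_of_nonneg hφ, ← integralOn_of_restr_eq_self hA hφ hr]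
  exact (P.ind_le_adjoint_ind_iff hA).1 h φ hφ

/-- The restriction of a positive invariant function to an absorbing set is invariant. -/
theorem map_restr_of_absorbing (h : ind hA ≤ P.adjoint (ind hA)) {f : Lp ℝ 1 m} (hf : 0 ≤ f)
    (hPf : P.toLinearMap f = f) : P.toLinearMap (restr hA f) = restr hA f := by
  have h0 := restr_nonneg hA hf
  refine P.map_eq_of_map_le h0 ?_
  rw [← restr_map_eq_of_absorbing h h0 (restr_restr hA f)]
  refine restr_mono hA ?_
  conv_rhs => rw [← hPf]
  exact P.map_mono (restr_le hA hf)

theorem map_restr_compl_of_absorbing (h : ind hA ≤ P.adjoint (ind hA)) {f : Lp ℝ 1 m} (hf : 0 ≤ f)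
    (hPf : P.toLinearMap f = f) : P.toLinearMap (restr hA.compl f) = restr hA.compl f := by
  have : restr hA.compl f = f - restr hA f := by
    rw [eq_sub_iff_add_eq, add_comm, restr_add_restr_compl]
  rw [this, map_sub, map_restr_of_absorbing h hf hPf, hPf]

theorem isClosed_restr_eq_self : IsClosed {φ : Lp ℝ 1 m | restr hA φ = φ} :=
  isClosed_eq (restr hA).continuous continuous_id

theorem restr_eq_self_of_le {φ ψ : Lp ℝ 1 m} (hφ : 0 ≤ φ) (h : φ ≤ ψ) (hψ : restr hA ψ = ψ) :
    restr hA φ = φ := by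
  rw [restr_eq_self_iff] at hψ ⊢
  filter_upwards [hψ, (Lp.coeFn_nonneg _).2 hφ, (Lp.coeFn_le _ _).2 h] with x h1 h2 h3 hx
  exact le_antisymm (h3.trans_eq (h1 hx)) h2

theorem restr_supp_self (f : Lp ℝ 1 m) : restr (measurableSet_supp f) f = f := by
  rw [restr_eq_self_iff]
  exact ae_of_all _ fun x hx => not_not.1 hx

/-- The support of a positive invariant function is absorbing. -/
theorem absorbing_supp {f : Lp ℝ 1 m} (hf : 0 ≤ f) (hPf : P.toLinearMap f = f) :
    ind (measurableSet_supp f) ≤ P.adjoint (ind (measurableSet_supp f)) := by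
  rw [ind_le_adjoint_ind_iff]
  intro φ hφ
  set hS := measurableSet_supp f
  have h0 := restr_nonneg hS hφ
  -- `P` maps the functions dominated by a multiple of `f` to such functions; pass to the limit
  have hlim : Tendsto (fun k : ℕ => P.toCLM (restr hS φ ⊓ (k : ℝ) • f)) atTop
      (𝓝 (P.toCLM (restr hS φ))) := by
    refine (P.toCLM.continuous.tendsto _).comp (Lp.tendsto_inf_nat_smul h0 hf ?_)
    filter_upwards [(restr_eq_self_iff hS).1 (restr_restr hS φ)] with x hx h
    exact hx fun h' => h' h
  have hmem : restr hS (P.toLinearMap (restr hS φ)) = P.toLinearMap (restr hS φ) := by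
    refine (isClosed_restr_eq_self (hA := hS)).mem_of_tendsto hlim
      (Eventually.of_forall fun k => ?_)
    have hk : (0 : Lp ℝ 1 m) ≤ (k : ℝ) • f := smul_nonneg k.cast_nonneg hf
    refine restr_eq_self_of_le (ψ := (k : ℝ) • f) (P.nonneg' _ (le_inf h0 hk)) ?_ ?_
    · have := P.map_mono (inf_le_right : restr hS φ ⊓ (k : ℝ) • f ≤ (k : ℝ) • f)
      rwa [map_smul, hPf] at this
    · rw [map_smul, restr_supp_self]
  calc integralOn hS φ = ‖restr hS φ‖ := integralOn_eq_norm_restr hS hφ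
    _ = ‖P.toLinearMap (restr hS φ)‖ := (P.norm_map_of_nonneg h0).symm
    _ = integralOn hS (P.toLinearMap (restr hS φ)) :=
      (integralOn_of_restr_eq_self hS (P.nonneg' _ h0) hmem).symm
    _ ≤ integralOn hS (P.toLinearMap φ) := integralOn_mono hS (P.map_mono (restr_le hS hφ))

end Absorbing

end MarkovOperator

/-! ### Weak limits of truncations along an ultrafilter -/

namespace MarkovOperator

section WeakLimit

variable {X : Type*} [MeasurableSpace X] {m : Measure X} [IsProbabilityMeasure m]

/-- Order intervals `[0, k]` of `L¹` are weakly compact: a bounded sequence of functions converges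
weakly in `L¹` along any ultrafilter. -/
theorem exists_weak_limit_of_le_smul_oneLp (U : Ultrafilter ℕ) {u : ℕ → Lp ℝ 1 m} {k : ℝ}
    (h0 : ∀ n, 0 ≤ u n) (hk : ∀ n, u n ≤ k • oneLp m) :
    ∃ v : Lp ℝ 1 m, ∀ l : Lp ℝ 1 m →L[ℝ] ℝ, Tendsto (fun n => l (u n)) U (𝓝 (l v)) := by
  have hbd : ∀ n, ∀ᵐ x ∂m, 0 ≤ u n x ∧ u n x ≤ k := fun n => by
    filter_upwards [(Lp.coeFn_nonneg _).2 (h0 n), (Lp.coeFn_le _ _).2 (hk n),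
      Lp.coeFn_smul k (oneLp m), coeFn_oneLp (m := m)] with x h1 h2 h3 h4
    refine ⟨h1, h2.trans_eq ?_⟩
    rw [h3, Pi.smul_apply, h4, smul_eq_mul, mul_one]
  have hbd' : ∀ n, ∀ᵐ x ∂m, ‖u n x‖ ≤ k := fun n => by
    filter_upwards [hbd n] with x hx
    rw [Real.norm_of_nonneg hx.1]
    exact hx.2
  have hmem : ∀ n, MemLp (u n) ∞ m := fun n =>
    memLp_top_of_bound (Lp.memLp (u n)).1 k (hbd' n)
  let w : ℕ → Lp ℝ ∞ m := fun n => (hmem n).toLp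
  have hw : ∀ n, (w n : X → ℝ) =ᵐ[m] u n := fun n => (hmem n).coeFn_toLp
  -- `u n` acts on `L¹` as a functional of norm at most `k`
  have hwn : ∀ n (φ : Lp ℝ 1 m), |linftyPairing m (w n) φ| ≤ k * ‖φ‖ := fun n φ => by
    rw [linftyPairing_apply, L1.norm_eq_integral_norm, ← integral_const_mul, ← Real.norm_eq_abs]
    refine norm_integral_le_of_norm_le ((L1.integrable_coeFn φ).norm.const_mul k) ?_
    filter_upwards [hw n, hbd' n] with x h1 h2
    rw [norm_mul, h1]
    gcongr
  have hk0 : 0 ≤ k := by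
    have := (abs_nonneg _).trans (hwn 0 (oneLp m))
    rwa [oneLp_mem_densities.2, mul_one] at this
  -- Banach–Alaoglu in the dual of `L¹`
  let W : ℕ → WeakDual ℝ (Lp ℝ 1 m) := fun n => StrongDual.toWeakDual (linftyPairing m (w n))
  obtain ⟨y, -, hy⟩ := (WeakDual.isCompact_closedBall (𝕜 := ℝ) (E := Lp ℝ 1 m)
    0 k).ultrafilter_le_nhds (U.map W) (by
      rw [le_principal_iff, Ultrafilter.mem_coe, Ultrafilter.mem_map]
      refine univ_mem' fun n => ?_
      change linftyPairing m (w n) ∈ Metric.closedBall 0 k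
      rw [mem_closedBall_zero_iff]
      exact ContinuousLinearMap.opNorm_le_bound _ hk0 (hwn n))
  obtain ⟨v, hv⟩ := linftyPairing_surjective m (WeakDual.toStrongDual y)
  have hlim : ∀ φ : Lp ℝ 1 m,
      Tendsto (fun n => linftyPairing m (w n) φ) U (𝓝 (linftyPairing m v φ)) := fun φ => by
    have h1 : Tendsto W U (𝓝 y) := hy
    rw [hv]
    exact ((WeakDual.eval_continuous φ).tendsto y).comp h1
  -- the limit lies in `L^∞`, hence in `L¹`; the functionals on `L¹` are the `L^∞` functions, which
  -- are themselves in `L¹`, so that the pairing may be read the other way round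
  have hvL : MemLp v 1 m := (Lp.memLp v).mono_exponent le_top
  refine ⟨hvL.toLp, fun l => ?_⟩
  obtain ⟨ψ, rfl⟩ := linftyPairing_surjective m l
  have hψL : MemLp ψ 1 m := (Lp.memLp ψ).mono_exponent le_top
  have e1 : ∀ n, linftyPairing m ψ (u n) = linftyPairing m (w n) hψL.toLp := fun n => by
    rw [linftyPairing_apply, linftyPairing_apply]
    refine integral_congr_ae ?_
    filter_upwards [hw n, hψL.coeFn_toLp] with x h1 h2
    rw [h1, h2, mul_comm]
  have e2 : linftyPairing m ψ hvL.toLp = linftyPairing m v hψL.toLp := by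
    rw [linftyPairing_apply, linftyPairing_apply]
    refine integral_congr_ae ?_
    filter_upwards [hvL.coeFn_toLp, hψL.coeFn_toLp] with x h1 h2
    rw [h1, h2, mul_comm]
  rw [e2]
  exact (hlim _).congr fun n => (e1 n).symm

theorem le_of_weak_tendsto {U : Ultrafilter ℕ} {u u' : ℕ → Lp ℝ 1 m} {v v' : Lp ℝ 1 m}
    (hu : ∀ l : Lp ℝ 1 m →L[ℝ] ℝ, Tendsto (fun n => l (u n)) U (𝓝 (l v)))
    (hu' : ∀ l : Lp ℝ 1 m →L[ℝ] ℝ, Tendsto (fun n => l (u' n)) U (𝓝 (l v')))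
    (h : ∀ n, u n ≤ u' n) : v ≤ v' :=
  le_of_integralOn_le fun _ hA =>
    le_of_tendsto_of_tendsto' (hu _) (hu' _) fun n => integralOn_mono hA (h n)

/-- For a bounded sequence `f n ≥ 0` of `L¹`, the weak limits `v k` of the truncations `f n ⊓ k`
along an ultrafilter increase to some `g`. In general mass is lost in passing from `f n` to `g`:
`g` represents the countably additive part of the limit functional of the `f n`. -/
theorem exists_truncated_weak_limit (U : Ultrafilter ℕ) {f : ℕ → Lp ℝ 1 m} {C : ℝ}
    (h0 : ∀ n, 0 ≤ f n) (hC : ∀ n, ‖f n‖ ≤ C) :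
    ∃ (v : ℕ → Lp ℝ 1 m) (g : Lp ℝ 1 m), (∀ k, 0 ≤ v k) ∧ (∀ k, v k ≤ g) ∧
      Tendsto v atTop (𝓝 g) ∧ ∀ k : ℕ, ∀ l : Lp ℝ 1 m →L[ℝ] ℝ,
        Tendsto (fun n => l (f n ⊓ (k : ℝ) • oneLp m)) U (𝓝 (l (v k))) := by
  have hk0 : ∀ k : ℕ, (0 : Lp ℝ 1 m) ≤ (k : ℝ) • oneLp m := fun k =>
    smul_nonneg k.cast_nonneg oneLp_nonneg
  have ht0 : ∀ k n : ℕ, 0 ≤ f n ⊓ (k : ℝ) • oneLp m := fun k n => le_inf (h0 n) (hk0 k)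
  choose v hv using fun k : ℕ => exists_weak_limit_of_le_smul_oneLp U
    (u := fun n => f n ⊓ (k : ℝ) • oneLp m) (ht0 k) fun n => inf_le_right
  have hv0 : ∀ k, 0 ≤ v k := fun k =>
    le_of_weak_tendsto (U := U) (u := fun _ => 0) (fun l => tendsto_const_nhds) (hv k) (ht0 k)
  have hmono : Monotone v := fun i j hij =>
    le_of_weak_tendsto (hv i) (hv j) fun n => inf_le_inf_left _
      (smul_le_smul_of_nonneg_right (by exact_mod_cast hij) oneLp_nonneg)
  have hbd : ∀ k, ‖v k‖ ≤ C := fun k => by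
    rw [norm_eq_integralOn_univ (hv0 k)]
    refine le_of_tendsto' (hv k _) fun n => ?_
    rw [← norm_eq_integralOn_univ (ht0 k n)]
    exact (Lp.norm_le_of_le (ht0 k n) inf_le_left).trans (hC n)
  obtain ⟨g, hg, hle⟩ := Lp.exists_tendsto_of_monotone hmono (hv0 0) hbd
  exact ⟨v, g, hv0, hle, hg, hv⟩

/-- A sequence in an order interval `[0, h]` of `L¹` converges weakly along any ultrafilter. -/
theorem exists_weak_limit_of_le (U : Ultrafilter ℕ) {f : ℕ → Lp ℝ 1 m} {h : Lp ℝ 1 m}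
    (h0 : ∀ n, 0 ≤ f n) (hf : ∀ n, f n ≤ h) :
    ∃ g : Lp ℝ 1 m, ∀ l : Lp ℝ 1 m →L[ℝ] ℝ, Tendsto (fun n => l (f n)) U (𝓝 (l g)) := by
  obtain ⟨v, g, hv0, hvg, hg, hv⟩ := exists_truncated_weak_limit U h0
    fun n => Lp.norm_le_of_le (h0 n) (hf n)
  refine ⟨g, fun l => ?_⟩
  have hh : 0 ≤ h := (h0 0).trans (hf 0)
  have h1 : Tendsto (fun k : ℕ => ‖l‖ * ‖h ⊓ (k : ℝ) • oneLp m - h‖) atTop (𝓝 0) := by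
    simpa using (tendsto_iff_norm_sub_tendsto_zero.1 (tendsto_inf_nat_smul_oneLp hh)).const_mul ‖l‖
  have h2 : Tendsto (fun k => l (v k)) atTop (𝓝 (l g)) := (l.continuous.tendsto _).comp hg
  rw [Metric.tendsto_nhds]
  intro ε hε
  obtain ⟨k, hk1, hk2⟩ := ((h1.eventually (gt_mem_nhds (by positivity : 0 < ε / 3))).and
    (Metric.tendsto_nhds.1 h2 (ε / 3) (by positivity))).exists
  filter_upwards [Metric.tendsto_nhds.1 (hv k l) (ε / 3) (by positivity)] with n hn
  have h3 : |l (f n) - l (f n ⊓ (k : ℝ) • oneLp m)| < ε / 3 := by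
    refine lt_of_le_of_lt ?_ hk1
    rw [← map_sub, ← Real.norm_eq_abs]
    refine (l.le_opNorm _).trans ?_
    gcongr
    rw [norm_sub_rev _ h]
    exact Lp.norm_le_of_le (sub_nonneg.2 inf_le_left) (sub_inf_le_sub_inf _ (hf n))
  rw [Real.dist_eq] at *
  rw [abs_lt] at *
  constructor <;> linarith [h3.1, h3.2, hn.1, hn.2, hk2.1, hk2.2]

end WeakLimit

/-! ### Invariant functions obtained as limits of averages -/

section InvariantLimit

variable {X : Type*} [MeasurableSpace X] {m : Measure X} (P : MarkovOperator m)

/-- The truncated weak limit of the averages of a positive function is invariant. -/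
theorem exists_invariant_truncated_limit [IsProbabilityMeasure m] (U : Ultrafilter ℕ)
    (hU : (U : Filter ℕ) ≤ atTop) {φ : Lp ℝ 1 m} (hφ : 0 ≤ φ) :
    ∃ g v : Lp ℝ 1 m, P.toLinearMap g = g ∧ 0 ≤ v ∧ v ≤ g ∧
      ∀ l : Lp ℝ 1 m →L[ℝ] ℝ, Tendsto (fun n => l (P.avg n φ ⊓ oneLp m)) U (𝓝 (l v)) := by
  obtain ⟨v, g, hv0, hvg, hg, hv⟩ := exists_truncated_weak_limit U (P.avg_nonneg hφ)
    (P.norm_avg_le φ)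
  refine ⟨g, v 1, ?_, hv0 1, hvg 1, by simpa using hv 1⟩
  refine P.map_eq_of_map_le ((hv0 0).trans (hvg 0)) ?_
  set w := P.toLinearMap (oneLp m) with hw
  have hw0 : 0 ≤ w := P.nonneg' _ oneLp_nonneg
  have key : ∀ k, P.toLinearMap (v k) ≤ g := by
    intro k
    refine le_of_integralOn_le fun A hA => ?_
    set l := integralOn (m := m) hA
    have hkw : 0 ≤ (k : ℝ) • w := smul_nonneg k.cast_nonneg hw0
    -- `P (f ⊓ k) ≤ P f ⊓ k w ≤ P f ⊓ s + (k w - s)⁺`, and the last term is small for large `s`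
    have hs : ∀ s : ℕ, l (P.toLinearMap (v k)) ≤
        l g + ‖(k : ℝ) • w - (k : ℝ) • w ⊓ (s : ℝ) • oneLp m‖ := by
      intro s
      have h1 : Tendsto (fun n => l (P.toLinearMap (P.avg n φ ⊓ (k : ℝ) • oneLp m))) U
          (𝓝 (l (P.toLinearMap (v k)))) := hv k (l.comp P.toCLM)
      have h2 : Tendsto (fun n => l (P.avg n φ ⊓ (s : ℝ) • oneLp m)
          + ‖P.avg n φ - P.toLinearMap (P.avg n φ)‖
          + ‖(k : ℝ) • w - (k : ℝ) • w ⊓ (s : ℝ) • oneLp m‖) U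
          (𝓝 (l (v s) + 0 + ‖(k : ℝ) • w - (k : ℝ) • w ⊓ (s : ℝ) • oneLp m‖)) :=
        ((hv s l).add ((tendsto_zero_iff_norm_tendsto_zero.1
          (P.tendsto_avg_sub_map_avg φ)).mono_left hU)).add tendsto_const_nhds
      have h3 := le_of_tendsto_of_tendsto' h1 h2 fun n => ?_
      · have := integralOn_mono hA (hvg s)
        linarith
      set f := P.avg n φ with hf
      have hf0 : 0 ≤ f := P.avg_nonneg hφ n
      set c := (s : ℝ) • oneLp m with hc
      have hx1 : P.toLinearMap (f ⊓ (k : ℝ) • oneLp m) ≤ P.toLinearMap f :=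
        P.map_mono inf_le_left
      have hx2 : P.toLinearMap (f ⊓ (k : ℝ) • oneLp m) ≤ (k : ℝ) • w := by
        rw [hw, ← map_smul]
        exact P.map_mono inf_le_right
      set x := P.toLinearMap (f ⊓ (k : ℝ) • oneLp m) with hx
      have e1 : l x = l (x ⊓ c) + l (x - x ⊓ c) := by rw [← map_add]; congr 1; abel
      have e2 : l (x - x ⊓ c) ≤ ‖(k : ℝ) • w - (k : ℝ) • w ⊓ c‖ :=
        (integralOn_mono hA (sub_inf_le_sub_inf c hx2)).trans
          (integralOn_le_norm hA (sub_nonneg.2 inf_le_left))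
      have e3 : l (x ⊓ c) ≤ l (P.toLinearMap f ⊓ c) :=
        integralOn_mono hA (inf_le_inf_right c hx1)
      have e4 : l (P.toLinearMap f ⊓ c) - l (f ⊓ c) ≤ ‖f - P.toLinearMap f‖ := by
        rw [← map_sub]
        refine (le_abs_self _).trans ((abs_integralOn_le hA _).trans ?_)
        rw [norm_sub_rev f]
        exact norm_inf_sub_inf_le_norm _ _ _
      linarith
    have hlim : Tendsto (fun s : ℕ =>
        l g + ‖(k : ℝ) • w - (k : ℝ) • w ⊓ (s : ℝ) • oneLp m‖) atTop (𝓝 (l g + 0)) := by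
      refine tendsto_const_nhds.add ?_
      have := tendsto_iff_norm_sub_tendsto_zero.1 (tendsto_inf_nat_smul_oneLp hkw)
      exact this.congr fun s => norm_sub_rev _ _
    rw [← add_zero (l g)]
    exact ge_of_tendsto' hlim hs
  exact le_of_tendsto' ((P.toCLM.continuous.tendsto g).comp hg) key

/-- **Mean ergodic theorem** (Yosida): if the averages of `φ` converge weakly along some
ultrafilter, then they converge in norm. -/
theorem tendsto_avg_of_weak_tendsto {U : Ultrafilter ℕ} (hU : (U : Filter ℕ) ≤ atTop)
    {φ ψ : Lp ℝ 1 m}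
    (h : ∀ l : Lp ℝ 1 m →L[ℝ] ℝ, Tendsto (fun n => l (P.avg n φ)) U (𝓝 (l ψ))) :
    P.toLinearMap ψ = ψ ∧ Tendsto (fun n => P.avg n φ) atTop (𝓝 ψ) := by
  have hψ : P.toLinearMap ψ = ψ := by
    by_contra hne
    obtain ⟨l, hl⟩ := SeparatingDual.exists_separating_of_ne (R := ℝ) hne
    refine hl (tendsto_nhds_unique (h (l.comp P.toCLM)) ?_)
    have h1 : Tendsto (fun n => l (P.avg n φ - P.toLinearMap (P.avg n φ))) U (𝓝 (l 0)) :=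
      (l.continuous.tendsto _).comp ((P.tendsto_avg_sub_map_avg φ).mono_left hU)
    rw [map_zero] at h1
    have := (h l).sub h1
    rw [sub_zero] at this
    refine this.congr fun n => ?_
    rw [map_sub, sub_sub_cancel]
    rfl
  refine ⟨hψ, ?_⟩
  let R : Submodule ℝ (Lp ℝ 1 m) := LinearMap.range (LinearMap.id - P.toLinearMap)
  -- `φ - ψ` lies in the closed range of `1 - P`, by the Hahn–Banach theorem
  have hmem : φ - ψ ∈ closure (R : Set (Lp ℝ 1 m)) := by
    by_contra hne
    obtain ⟨l, c, hl, hc⟩ := geometric_hahn_banach_closed_point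
      (Submodule.convex (𝕜 := ℝ) R).closure isClosed_closure hne
    have hl0 : ∀ y, l (y - P.toLinearMap y) = 0 := fun y => by
      have hb : ∀ t : ℝ, t * l (y - P.toLinearMap y) < c := fun t => by
        rw [← smul_eq_mul, ← map_smul]
        exact hl _ (subset_closure (R.smul_mem t ⟨y, rfl⟩))
      by_contra h0
      have := hb ((c / l (y - P.toLinearMap y)))
      rw [div_mul_cancel₀ _ h0] at this
      exact lt_irrefl _ this
    have hc0 : 0 < c := by simpa using hl 0 (subset_closure R.zero_mem)
    have hpow : ∀ i, l ((P.toLinearMap ^ i) φ) = l φ := fun i => by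
      induction i with
      | zero => simp
      | succ i ih =>
        have := hl0 ((P.toLinearMap ^ i) φ)
        rw [map_sub, sub_eq_zero] at this
        rw [pow_succ_apply, ← this, ih]
    have hlψ : l ψ = l φ := by
      refine tendsto_nhds_unique (h l) (tendsto_const_nhds.congr' ?_)
      filter_upwards [hU (eventually_ge_atTop 1)] with n hn
      rw [apply_avg, Finset.sum_congr rfl fun i _ => hpow i, inv_mul_sum_const hn]
    rw [map_sub, hlψ, sub_self] at hc
    exact absurd hc hc0.not_gt
  have hzero : Tendsto (fun n => P.avg n (φ - ψ)) atTop (𝓝 0) := by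
    rw [Metric.tendsto_nhds]
    intro ε hε
    obtain ⟨y, ⟨z, rfl⟩, hz⟩ := Metric.mem_closure_iff.1 hmem (ε / 2) (by positivity)
    filter_upwards [Metric.tendsto_nhds.1 (P.tendsto_avg_sub_map z) (ε / 2) (by positivity)]
      with n hn
    rw [dist_eq_norm] at hz hn ⊢
    rw [sub_zero] at hn ⊢
    set y := (LinearMap.id - P.toLinearMap : Lp ℝ 1 m →ₗ[ℝ] Lp ℝ 1 m) z with hy
    have hy' : z - P.toLinearMap z = y := rfl
    rw [hy'] at hn
    calc ‖P.avg n (φ - ψ)‖ = ‖P.avg n (φ - ψ - y) + P.avg n y‖ := by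
          rw [← map_add, sub_add_cancel]
      _ ≤ ‖φ - ψ - y‖ + ‖P.avg n y‖ := (norm_add_le _ _).trans (by gcongr; exact P.norm_avg_le _ _)
      _ < ε := by linarith
  have := hzero.add_const ψ
  rw [zero_add] at this
  refine this.congr' ?_
  filter_upwards [eventually_ge_atTop 1] with n hn
  rw [map_sub, P.avg_of_map_eq hψ hn, sub_add_cancel]

/-- The averages of a positive function dominated by an invariant function converge in norm. -/
theorem exists_tendsto_avg_of_le [IsProbabilityMeasure m] {φ h : Lp ℝ 1 m} (hφ : 0 ≤ φ)
    (hle : φ ≤ h) (hh : P.toLinearMap h = h) :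
    ∃ ψ, 0 ≤ ψ ∧ ψ ≤ h ∧ P.toLinearMap ψ = ψ ∧ Tendsto (fun n => P.avg n φ) atTop (𝓝 ψ) := by
  have h0 : 0 ≤ h := hφ.trans hle
  have hb : ∀ n, P.avg n φ ≤ h := fun n => by
    rcases Nat.eq_zero_or_pos n with rfl | hn
    · simpa [avg_apply] using h0
    · conv_rhs => rw [← P.avg_of_map_eq hh hn]
      exact P.avg_mono hle n
  obtain ⟨ψ, hψ⟩ := exists_weak_limit_of_le (hyperfilter ℕ) (P.avg_nonneg hφ) hb
  obtain ⟨h1, h2⟩ := P.tendsto_avg_of_weak_tendsto Nat.hyperfilter_le_atTop hψ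
  exact ⟨ψ, ge_of_tendsto' h2 (P.avg_nonneg hφ), le_of_tendsto' h2 hb, h1, h2⟩

end InvariantLimit

end MarkovOperator

/-! ### Maximal support in terms of the iterates on `L¹(m)` -/

namespace MarkovOperator

section MaximalSupport

variable {X : Type*} [MeasurableSpace X] {m : Measure X} [IsProbabilityMeasure m]
  {P : MarkovOperator m} {S : Set X} {hS : MeasurableSet S}

theorem linftyPairing_adjoint_pow_ind (n : ℕ) (φ : Lp ℝ 1 m) :
    linftyPairing m ((P.adjoint ^ n) (ind hS)) φ = integralOn hS ((P.toLinearMap ^ n) φ) :=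
  P.linftyPairing_adjoint_pow n _ φ

theorem integralOn_pow_le_succ (h : ind hS ≤ P.adjoint (ind hS)) {φ : Lp ℝ 1 m} (hφ : 0 ≤ φ)
    (n : ℕ) :
    integralOn hS ((P.toLinearMap ^ n) φ) ≤ integralOn hS ((P.toLinearMap ^ (n + 1)) φ) := by
  rw [pow_succ_apply]
  exact (P.ind_le_adjoint_ind_iff hS).1 h _ (P.pow_nonneg hφ n)

theorem antitone_integralOn_compl_pow (h : ind hS ≤ P.adjoint (ind hS)) {φ : Lp ℝ 1 m}
    (hφ : 0 ≤ φ) : Antitone fun n => integralOn hS.compl ((P.toLinearMap ^ n) φ) := by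
  refine antitone_nat_of_succ_le fun n => ?_
  have h1 := norm_eq_integralOn_add_compl hS (P.pow_nonneg hφ n)
  have h2 := norm_eq_integralOn_add_compl hS (P.pow_nonneg hφ (n + 1))
  rw [P.norm_pow_of_nonneg hφ] at h1 h2
  have := integralOn_pow_le_succ h hφ n
  linarith

/-- The mass that ever arrives outside an absorbing set `S` starts outside `S`. -/
theorem integralOn_compl_pow_restr_compl (h : ind hS ≤ P.adjoint (ind hS)) {φ : Lp ℝ 1 m}
    (hφ : 0 ≤ φ) (n : ℕ) :
    integralOn hS.compl ((P.toLinearMap ^ n) (restr hS.compl φ)) =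
      integralOn hS.compl ((P.toLinearMap ^ n) φ) := by
  have h0 : integralOn hS.compl ((P.toLinearMap ^ n) (restr hS φ)) = 0 := by
    refine le_antisymm ?_ (integralOn_nonneg _ (P.pow_nonneg (restr_nonneg hS hφ) n))
    refine (antitone_integralOn_compl_pow h (restr_nonneg hS hφ) n.zero_le).trans ?_
    have h1 := norm_eq_integralOn_add_compl hS (restr_nonneg hS hφ)
    rw [integralOn_of_restr_eq_self hS (restr_nonneg hS hφ) (restr_restr hS φ)] at h1
    simp only [pow_zero, Module.End.one_apply]
    linarith
  conv_rhs => rw [← restr_add_restr_compl hS φ, map_add, map_add, h0, zero_add]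

/-- The functions `(P^*)^n 1_S` increase and stay below `1`, so that the convergence of
their integrals to `1` is enough. -/
theorem ae_tendsto_adjoint_pow_ind (h : ind hS ≤ P.adjoint (ind hS))
    (hlim : Tendsto (fun n => integralOn hS ((P.toLinearMap ^ n) (oneLp m))) atTop (𝓝 1)) :
    ∀ᵐ x ∂m, Tendsto (fun n : ℕ => ((P.adjoint ^ n) (ind hS) : X → ℝ) x) atTop (𝓝 1) := by
  have hint : ∀ ψ : Lp ℝ ∞ m, Integrable ψ m := fun ψ =>
    memLp_one_iff_integrable.1 ((Lp.memLp ψ).mono_exponent le_top)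
  have hval : ∀ n, ∫ x, ((P.adjoint ^ n) (ind hS) : X → ℝ) x ∂m =
      integralOn hS ((P.toLinearMap ^ n) (oneLp m)) := fun n => by
    rw [← linftyPairing_adjoint_pow_ind, linftyPairing_apply]
    refine integral_congr_ae ?_
    filter_upwards [coeFn_oneLp (m := m)] with x hx
    rw [hx, mul_one]
  refine tendsto_of_integral_tendsto_of_monotone (f := fun n => ((P.adjoint ^ n) (ind hS) : X → ℝ))
    (F := fun _ => (1 : ℝ)) (fun n => hint ((P.adjoint ^ n) (ind hS)))
    (integrable_const _) ?_ ?_ ?_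
  · simp_rw [hval]
    simpa using hlim
  · have hm : ∀ n, (P.adjoint ^ n) (ind hS) ≤ (P.adjoint ^ (n + 1)) (ind hS) := fun n =>
      le_of_linftyPairing_le fun φ hφ => by
        rw [linftyPairing_adjoint_pow_ind, linftyPairing_adjoint_pow_ind]
        exact integralOn_pow_le_succ h hφ n
    filter_upwards [ae_all_iff.2 fun n => (Lp.coeFn_le _ _).2 (hm n)] with x hx
    exact monotone_nat_of_le_succ hx
  · have hm : ∀ n, (P.adjoint ^ n) (ind hS) ≤ ind MeasurableSet.univ := fun n =>
      le_of_linftyPairing_le fun φ hφ => by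
        rw [linftyPairing_adjoint_pow_ind]
        refine (integralOn_le_norm hS (P.pow_nonneg hφ n)).trans_eq ?_
        rw [P.norm_pow_of_nonneg hφ, norm_eq_integralOn_univ hφ]
        rfl
    filter_upwards [ae_all_iff.2 fun n => (Lp.coeFn_le _ _).2 (hm n),
      coeFn_ind (m := m) MeasurableSet.univ] with x hx h1 n
    exact (hx n).trans_eq (by rw [h1, indicator_univ])

theorem tendsto_integralOn_compl_pow
    (h : ∀ᵐ x ∂m, Tendsto (fun n : ℕ => ((P.adjoint ^ n) (ind hS) : X → ℝ) x) atTop (𝓝 1))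
    {φ : Lp ℝ 1 m} (hφ : 0 ≤ φ) :
    Tendsto (fun n => integralOn hS.compl ((P.toLinearMap ^ n) φ)) atTop (𝓝 0) := by
  have hb : ∀ n, ∀ᵐ x ∂m, |((P.adjoint ^ n) (ind hS) : X → ℝ) x| ≤ 1 := fun n => by
    have h0 : 0 ≤ (P.adjoint ^ n) (ind hS) := le_of_linftyPairing_le fun φ hφ => by
      rw [linftyPairing_adjoint_pow_ind, map_zero, zero_apply]
      exact integralOn_nonneg hS (P.pow_nonneg hφ n)
    have hm : (P.adjoint ^ n) (ind hS) ≤ ind MeasurableSet.univ :=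
      le_of_linftyPairing_le fun φ hφ => by
        rw [linftyPairing_adjoint_pow_ind]
        refine (integralOn_le_norm hS (P.pow_nonneg hφ n)).trans_eq ?_
        rw [P.norm_pow_of_nonneg hφ, norm_eq_integralOn_univ hφ]
        rfl
    filter_upwards [(Lp.coeFn_le _ _).2 hm, (Lp.coeFn_nonneg _).2 h0,
      coeFn_ind (m := m) MeasurableSet.univ] with x hx h0 h1
    rw [abs_of_nonneg h0]
    exact hx.trans_eq (by rw [h1, indicator_univ])
  have key : Tendsto (fun n => linftyPairing m ((P.adjoint ^ n) (ind hS)) φ) atTop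
      (𝓝 (∫ x, 1 * φ x ∂m)) := by
    simp_rw [linftyPairing_apply]
    refine tendsto_integral_of_dominated_convergence (fun x => ‖φ x‖)
      (fun n => (Lp.stronglyMeasurable _).aestronglyMeasurable.mul
        (Lp.stronglyMeasurable _).aestronglyMeasurable) (L1.integrable_coeFn φ).norm ?_ ?_
    · intro n
      filter_upwards [hb n] with x hx
      rw [norm_mul]
      exact mul_le_of_le_one_left (norm_nonneg _) hx
    · filter_upwards [h] with x hx
      exact hx.mul_const _
  simp_rw [one_mul, ← norm_eq_integral_of_nonneg φ hφ, linftyPairing_adjoint_pow_ind] at key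
  have := (tendsto_const_nhds (x := ‖φ‖)).sub key
  rw [sub_self] at this
  refine this.congr fun n => ?_
  have := norm_eq_integralOn_add_compl hS (P.pow_nonneg hφ n)
  rw [P.norm_pow_of_nonneg hφ] at this
  linarith

end MaximalSupport

/-! ### Asymptotic mean constrictivity produces invariant densities -/

section ExistenceOfInvariantDensities

variable {X : Type*} [MeasurableSpace X] {m : Measure X} [IsProbabilityMeasure m]
  {P : MarkovOperator m}

theorem isBoundedUnder_integralOn_avg {E : Set X} (hE : MeasurableSet E) (φ : Lp ℝ 1 m) :
    IsBoundedUnder (· ≤ ·) atTop fun n => integralOn hE (P.avg n φ) :=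
  isBoundedUnder_of ⟨‖φ‖, fun n =>
    (le_abs_self _).trans ((abs_integralOn_le hE _).trans (P.norm_avg_le φ n))⟩

/-- Concentration of mass: the part of `T` where `f ≥ 1` has small measure and carries almost all
of the mass of `f` on `T`, as soon as `∫_T min(f, 1)` is small. -/
theorem exists_concentration_set {T : Set X} (hT : MeasurableSet T) {f : Lp ℝ 1 m}
    (hf : 0 ≤ f) : ∃ (E : Set X) (hE : MeasurableSet E),
      m.real E ≤ integralOn hT (f ⊓ oneLp m) ∧
      integralOn hT f ≤ integralOn hE f + integralOn hT (f ⊓ oneLp m) := by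
  have hE : MeasurableSet (T ∩ {x | 1 ≤ f x}) :=
    hT.inter (measurableSet_le measurable_const (Lp.stronglyMeasurable f).measurable)
  have hmin : 0 ≤ f ⊓ oneLp m := le_inf hf oneLp_nonneg
  refine ⟨_, hE, ?_, ?_⟩
  · have h1 : m.real (T ∩ {x | 1 ≤ f x}) = integralOn hE (oneLp m) := by
      rw [integralOn_apply, setIntegral_congr_ae (g := fun _ => (1 : ℝ)) hE
        ((coeFn_oneLp (m := m)).mono fun x hx _ => hx)]
      simp
    rw [h1, integralOn_eq_norm_restr _ oneLp_nonneg, integralOn_eq_norm_restr _ hmin]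
    refine Lp.norm_le_of_le (restr_nonneg _ oneLp_nonneg) ?_
    rw [← Lp.coeFn_le]
    filter_upwards [coeFn_restr hE (oneLp m), coeFn_restr hT (f ⊓ oneLp m), coeFn_oneLp (m := m),
      Lp.coeFn_inf f (oneLp m), (Lp.coeFn_nonneg _).2 hf] with x h1 h2 h3 h4 h5
    have h5 : 0 ≤ f x := h5
    rw [h1, h2]
    by_cases hx : x ∈ T
    · by_cases hx1 : 1 ≤ f x
      · have : x ∈ T ∩ {x | 1 ≤ f x} := ⟨hx, hx1⟩
        rw [indicator_of_mem this, indicator_of_mem hx, h4, Pi.inf_apply, h3]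
        exact le_inf hx1 le_rfl
      · have : x ∉ T ∩ {x | 1 ≤ f x} := fun h => hx1 h.2
        rw [indicator_of_notMem this, indicator_of_mem hx, h4, Pi.inf_apply, h3]
        exact le_inf h5 zero_le_one
    · have : x ∉ T ∩ {x | 1 ≤ f x} := fun h => hx h.1
      rw [indicator_of_notMem this, indicator_of_notMem hx]
  · rw [integralOn_eq_norm_restr _ hf, integralOn_eq_norm_restr _ hmin,
      integralOn_eq_norm_restr _ hf,
      ← Lp.norm_add_of_nonneg (restr_nonneg _ hf) (restr_nonneg _ hmin)]
    refine Lp.norm_le_of_le (restr_nonneg _ hf) ?_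
    rw [← Lp.coeFn_le]
    filter_upwards [coeFn_restr hE f, coeFn_restr hT (f ⊓ oneLp m), coeFn_oneLp (m := m),
      Lp.coeFn_inf f (oneLp m), (Lp.coeFn_nonneg _).2 hf, coeFn_restr hT f,
      Lp.coeFn_add (restr hE f) (restr hT (f ⊓ oneLp m))] with x h1 h2 h3 h4 h5 h6 h7
    have h5 : 0 ≤ f x := h5
    rw [h6, h7, Pi.add_apply, h1, h2]
    by_cases hx : x ∈ T
    · rw [indicator_of_mem hx, indicator_of_mem hx, h4, Pi.inf_apply, h3]
      by_cases hx1 : 1 ≤ f x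
      · have : x ∈ T ∩ {x | 1 ≤ f x} := ⟨hx, hx1⟩
        rw [indicator_of_mem this, inf_eq_right.2 hx1]
        linarith
      · have : x ∉ T ∩ {x | 1 ≤ f x} := fun h => hx1 h.2
        rw [indicator_of_notMem this, inf_eq_left.2 (not_le.1 hx1).le, zero_add]
    · have : x ∉ T ∩ {x | 1 ≤ f x} := fun h => hx h.1
      rw [indicator_of_notMem this, indicator_of_notMem hx, indicator_of_notMem hx, add_zero]

/-- If the averages of a density keep mass at least `κ` on `T` but do not charge the sets of
measure `< δ` with mass `κ`, then an invariant function lives partly on `T`. Otherwise the averages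
would tend to `0` in measure on `T` along a subsequence, and the union of the (small) sets on which
their mass concentrates would violate the hypothesis. -/
theorem exists_invariant_of_le_integralOn_avg {κ δ : ℝ} (hδ : 0 < δ) {φ : Lp ℝ 1 m} (hφ : 0 ≤ φ)
    (hsmall : ∀ (E : Set X) (hE : MeasurableSet E), m.real E < δ →
      limsup (fun n => integralOn hE (P.avg n φ)) atTop < κ)
    {T : Set X} (hT : MeasurableSet T) (hmass : ∀ n, 1 ≤ n → κ ≤ integralOn hT (P.avg n φ)) :
    ∃ g : Lp ℝ 1 m, P.toLinearMap g = g ∧ 0 ≤ g ∧ 0 < integralOn hT g := by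
  obtain ⟨ε, hε, hev⟩ : ∃ ε > 0, ∀ᶠ n in atTop, ε ≤ integralOn hT (P.avg n φ ⊓ oneLp m) := by
    by_contra! hcon
    have hfreq : ∀ k : ℕ, ∃ᶠ n in atTop,
        1 ≤ n ∧ integralOn hT (P.avg n φ ⊓ oneLp m) < δ / 2 / 2 / 2 ^ k := fun k =>
      ((hcon (δ / 2 / 2 / 2 ^ k) (by positivity)).and_eventually (eventually_ge_atTop 1)).mono
        fun n hn => ⟨hn.2, hn.1⟩
    obtain ⟨n, hn, hnk⟩ := extraction_forall_of_frequently hfreq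
    choose E hE hE1 hE2 using fun k =>
      exists_concentration_set hT (P.avg_nonneg hφ (n k))
    have hU : MeasurableSet (⋃ k, E k) := MeasurableSet.iUnion hE
    have hUδ : m.real (⋃ k, E k) < δ := by
      refine lt_of_le_of_lt ?_ (half_lt_self hδ)
      refine ENNReal.toReal_le_of_le_ofReal (by positivity) ?_
      refine (measure_iUnion_le E).trans ?_
      rw [← tsum_geometric_two' (δ / 2),
        ENNReal.ofReal_tsum_of_nonneg (fun k => by positivity) (summable_geometric_two' _)]
      refine ENNReal.tsum_le_tsum fun k => ?_
      rw [← ENNReal.ofReal_toReal (measure_ne_top m (E k))]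
      exact ENNReal.ofReal_le_ofReal ((hE1 k).trans (hnk k).2.le)
    obtain ⟨c, hc1, hc2⟩ := exists_between (hsmall _ hU hUδ)
    have hevc := eventually_lt_of_limsup_lt hc1 (isBoundedUnder_integralOn_avg hU φ)
    have hzero : Tendsto (fun k : ℕ => c + δ / 2 / 2 / 2 ^ k) atTop (𝓝 (c + 0)) :=
      tendsto_const_nhds.add (summable_geometric_two' (δ / 2)).tendsto_atTop_zero
    rw [add_zero] at hzero
    obtain ⟨k, hk1, hk2⟩ := ((hzero.eventually (gt_mem_nhds hc2)).and
      (hn.tendsto_atTop.eventually hevc)).exists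
    have hsub : integralOn (hE k) (P.avg (n k) φ) ≤ integralOn hU (P.avg (n k) φ) := by
      rw [integralOn_apply, integralOn_apply]
      exact setIntegral_mono_set (L1.integrable_coeFn _).integrableOn
        (ae_restrict_of_ae ((Lp.coeFn_nonneg _).2 (P.avg_nonneg hφ _)))
        (subset_iUnion E k).eventuallyLE
    linarith [hE2 k, (hnk k).2, hmass (n k) (hnk k).1]
  obtain ⟨g, v, hg, hv0, hvg, hv⟩ :=
    P.exists_invariant_truncated_limit (hyperfilter ℕ) Nat.hyperfilter_le_atTop hφ
  have h1 : ε ≤ integralOn hT v := ge_of_tendsto (hv _) (Nat.hyperfilter_le_atTop hev)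
  exact ⟨g, hg, hv0.trans hvg, hε.trans_le (h1.trans (integralOn_mono hT hvg))⟩

/-- If `P` fails to bring all mass of some `φ` into the absorbing set `S`, then a late iterate,
conditioned on the complement of `S`, keeps nearly all of its mass there forever. -/
theorem exists_density_le_integralOn_compl_pow {S : Set X} {hS : MeasurableSet S}
    (h : ind hS ≤ P.adjoint (ind hS)) {κ : ℝ} (hκ : κ < 1) {φ : Lp ℝ 1 m} (hφ : 0 ≤ φ)
    (hlim : ¬Tendsto (fun n => integralOn hS.compl ((P.toLinearMap ^ n) φ)) atTop (𝓝 0)) :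
    ∃ φ' ∈ densities m, ∀ n, κ ≤ integralOn hS.compl ((P.toLinearMap ^ n) φ') := by
  set c : ℕ → ℝ := fun n => integralOn hS.compl ((P.toLinearMap ^ n) φ) with hc
  have hc0 : ∀ n, 0 ≤ c n := fun n => integralOn_nonneg _ (P.pow_nonneg hφ n)
  have hbdd : BddBelow (range c) := ⟨0, by rintro _ ⟨n, rfl⟩; exact hc0 n⟩
  have htend := tendsto_atTop_ciInf (antitone_integralOn_compl_pow h hφ) hbdd
  have hpos : 0 < ⨅ n, c n := by
    refine lt_of_le_of_ne (le_ciInf hc0) fun h0 => hlim ?_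
    rw [h0]
    exact htend
  have hle : ∀ n, ⨅ n, c n ≤ c n := fun n => ciInf_le hbdd n
  obtain ⟨N, hN⟩ := ((htend.const_mul κ).eventually
    (gt_mem_nhds (by nlinarith : κ * ⨅ n, c n < ⨅ n, c n))).exists
  have hcN : 0 < c N := hpos.trans_le (hle N)
  have hψ := restr_nonneg hS.compl (P.pow_nonneg hφ N)
  refine ⟨(c N)⁻¹ • restr hS.compl ((P.toLinearMap ^ N) φ), ⟨smul_nonneg (by positivity) hψ, ?_⟩,
    fun n => ?_⟩
  · rw [Lp.norm_smul_of_nonneg (by positivity), ← integralOn_eq_norm_restr _ (P.pow_nonneg hφ N)]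
    exact inv_mul_cancel₀ hcN.ne'
  · rw [map_smul, map_smul, integralOn_compl_pow_restr_compl h (P.pow_nonneg hφ N),
      ← Module.End.mul_apply, ← pow_add, smul_eq_mul, inv_mul_eq_div, le_div_iff₀ hcN]
    exact hN.le.trans (hle (n + N))

/-- Conditioning a positive invariant function on the complement of an absorbing set gives an
invariant density. -/
theorem exists_invariantDensity_compl {S : Set X} {hS : MeasurableSet S}
    (h : ind hS ≤ P.adjoint (ind hS)) {g : Lp ℝ 1 m} (hPg : P.toLinearMap g = g) (hg : 0 ≤ g)
    (hpos : 0 < integralOn hS.compl g) :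
    ∃ b, P.IsInvariantDensity b ∧ ∀ᵐ x ∂m, x ∈ S → b x = 0 := by
  have hne : restr hS.compl g ≠ 0 := by
    rw [← norm_pos_iff, ← integralOn_eq_norm_restr _ hg]
    exact hpos
  refine ⟨‖restr hS.compl g‖⁻¹ • restr hS.compl g,
    ⟨inv_norm_smul_mem_densities (restr_nonneg _ hg) hne, ?_⟩, ?_⟩
  · rw [map_smul, map_restr_compl_of_absorbing h hg hPg]
  · filter_upwards [Lp.coeFn_smul ‖restr hS.compl g‖⁻¹ (restr hS.compl g),
      coeFn_restr hS.compl g] with x h1 h2 hx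
    rw [h1, Pi.smul_apply, h2, indicator_of_notMem (by simpa using hx), smul_zero]

end ExistenceOfInvariantDensities

end MarkovOperator

/-! ### Families of invariant densities with disjoint supports -/

theorem Lp.coeFn_finsetSum {X ι : Type*} [MeasurableSpace X] {m : Measure X} (s : Finset ι)
    (f : ι → Lp ℝ 1 m) : ((∑ i ∈ s, f i : Lp ℝ 1 m) : X → ℝ) =ᵐ[m] fun x => ∑ i ∈ s, f i x := by
  classical
  induction s using Finset.induction_on with
  | empty =>
    filter_upwards [Lp.coeFn_zero ℝ 1 m] with x hx
    rw [Finset.sum_empty, hx, Finset.sum_empty, Pi.zero_apply]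
  | insert i s hi ih =>
    filter_upwards [ih, Lp.coeFn_add (f i) (∑ i ∈ s, f i)] with x h1 h2
    rw [Finset.sum_insert hi, h2, Pi.add_apply, h1, Finset.sum_insert hi]

namespace MarkovOperator

section Families

variable {X : Type*} [MeasurableSpace X] {m : Measure X}

/-- A finite family of invariant densities with pairwise disjoint supports. -/
def IsDisjointInvariantFamily (P : MarkovOperator m) {r : ℕ} (h : Fin r → Lp ℝ 1 m) : Prop :=
  (∀ i, P.IsInvariantDensity (h i)) ∧ ∀ i j, i ≠ j → m (supp (h i) ∩ supp (h j)) = 0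

theorem measure_supp_inter_eq_zero_iff {a b : Lp ℝ 1 m} :
    m (supp a ∩ supp b) = 0 ↔ ∀ᵐ x ∂m, a x = 0 ∨ b x = 0 := by
  rw [measure_eq_zero_iff_ae_notMem]
  refine eventually_congr (ae_of_all _ fun x => ?_)
  simp only [supp, mem_inter_iff, mem_ofPred_eq]
  tauto

variable {P : MarkovOperator m} {r : ℕ} {h : Fin r → Lp ℝ 1 m}

theorem IsDisjointInvariantFamily.cons (hh : P.IsDisjointInvariantFamily h) {b : Lp ℝ 1 m}
    (hb : P.IsInvariantDensity b) (hd : ∀ i, m (supp b ∩ supp (h i)) = 0) :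
    P.IsDisjointInvariantFamily (Fin.cons b h : Fin (r + 1) → Lp ℝ 1 m) := by
  refine ⟨fun i => ?_, fun i j => ?_⟩
  · refine Fin.cases ?_ (fun i => ?_) i
    · simpa using hb
    · simpa using hh.1 i
  · refine Fin.cases ?_ (fun i => ?_) i <;> refine Fin.cases ?_ (fun j => ?_) j
    · intro hne
      exact absurd rfl hne
    · intro _
      simpa using hd j
    · intro _
      rw [inter_comm]
      simpa using hd i
    · intro hne
      simpa using hh.2 i j fun h => hne (congrArg Fin.succ h)

theorem IsDisjointInvariantFamily.update (hh : P.IsDisjointInvariantFamily h) (i : Fin r)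
    {a : Lp ℝ 1 m} (ha : P.IsInvariantDensity a) (hle : ∀ᵐ x ∂m, h i x = 0 → a x = 0) :
    P.IsDisjointInvariantFamily (Function.update h i a) := by
  have hd : ∀ j, j ≠ i → m (supp a ∩ supp (h j)) = 0 := fun j hj => by
    have := hh.2 i j hj.symm
    rw [measure_supp_inter_eq_zero_iff] at this ⊢
    filter_upwards [this, hle] with x h1 h2
    exact h1.imp_left h2
  refine ⟨fun j => ?_, fun j k hjk => ?_⟩
  · rcases eq_or_ne j i with rfl | hj
    · simpa using ha
    · simpa [hj] using hh.1 j
  · rcases eq_or_ne j i with rfl | hj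
    · simpa [hjk.symm] using hd k hjk.symm
    · rcases eq_or_ne k i with rfl | hk
      · rw [inter_comm]
        simpa [hj] using hd j hj
      · simpa [hj, hk] using hh.2 j k hjk

theorem coeFn_inv_smul_sum (h : Fin r → Lp ℝ 1 m) :
    (((r : ℝ)⁻¹ • ∑ i, h i : Lp ℝ 1 m) : X → ℝ) =ᵐ[m] fun x => (r : ℝ)⁻¹ * ∑ i, h i x := by
  filter_upwards [Lp.coeFn_finsetSum Finset.univ h, Lp.coeFn_smul (r : ℝ)⁻¹ (∑ i, h i)] with x h1 h2
  rw [h2, Pi.smul_apply, h1, smul_eq_mul]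

theorem ae_inv_smul_sum_eq_zero_iff (h0 : ∀ i, 0 ≤ h i) :
    ∀ᵐ x ∂m, ((r : ℝ)⁻¹ • ∑ i, h i : Lp ℝ 1 m) x = 0 ↔ ∀ i, h i x = 0 := by
  filter_upwards [coeFn_inv_smul_sum h, ae_all_iff.2 fun i => (Lp.coeFn_nonneg _).2 (h0 i)]
    with x h1 h2
  rw [h1, mul_eq_zero, inv_eq_zero, Nat.cast_eq_zero,
    Finset.sum_eq_zero_iff_of_nonneg fun i _ => h2 i]
  constructor
  · rintro (rfl | h3) i
    · exact i.elim0
    · exact h3 i (Finset.mem_univ i)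
  · exact fun h3 => Or.inr fun i _ => h3 i

theorem inv_smul_sum_nonneg (h0 : ∀ i, 0 ≤ h i) : 0 ≤ ((r : ℝ)⁻¹ • ∑ i, h i : Lp ℝ 1 m) :=
  smul_nonneg (by positivity) (Finset.sum_nonneg fun i _ => h0 i)

theorem map_inv_smul_sum (hP : ∀ i, P.toLinearMap (h i) = h i) :
    P.toLinearMap ((r : ℝ)⁻¹ • ∑ i, h i) = (r : ℝ)⁻¹ • ∑ i, h i := by
  rw [map_smul, map_sum, Finset.sum_congr rfl fun i _ => hP i]

variable [IsProbabilityMeasure m]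

theorem IsDisjointInvariantFamily.card_mul_le (hh : P.IsDisjointInvariantFamily h) {δ : ℝ}
    (hδ : ∀ f, P.IsInvariantDensity f → δ ≤ m.real (supp f)) : r * δ ≤ 1 := by
  have h1 := sum_measure_le_measure_univ (μ := m) (s := Finset.univ) (t := fun i => supp (h i))
    (fun i _ => (measurableSet_supp (h i)).nullMeasurableSet)
    (fun i _ j _ hij => hh.2 i j hij)
  rw [measure_univ] at h1
  have h2 : ∑ i, m.real (supp (h i)) ≤ 1 := by
    have := ENNReal.toReal_mono ENNReal.one_ne_top h1
    rwa [ENNReal.toReal_sum fun i _ => measure_ne_top _ _, ENNReal.toReal_one] at this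
  refine le_trans ?_ h2
  have := Finset.sum_le_sum fun i (_ : i ∈ Finset.univ) => hδ _ (hh.1 i)
  simpa using this

/-- A maximal family of invariant densities with disjoint supports consists of ergodic densities:
otherwise a member could be split along an absorbing set. -/
theorem IsDisjointInvariantFamily.isErgodicDensity (hh : P.IsDisjointInvariantFamily h)
    (hmax : ∀ h' : Fin (r + 1) → Lp ℝ 1 m, ¬P.IsDisjointInvariantFamily h') (i : Fin r) :
    P.IsErgodicDensity (h i) := by
  refine ⟨hh.1 i, fun A hA habs => ?_⟩
  by_contra! hcon
  rw [← integralOn_apply hA] at hcon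
  obtain ⟨⟨hi0, hi1⟩, hPi⟩ := hh.1 i
  have hsum := norm_eq_integralOn_add_compl hA hi0
  rw [hi1] at hsum
  have hb : restr hA.compl (h i) ≠ 0 := by
    rw [← norm_ne_zero_iff, ← integralOn_eq_norm_restr _ hi0]
    intro h0
    rw [h0, add_zero] at hsum
    exact hcon.2 hsum.symm
  have ha : restr hA (h i) ≠ 0 := by
    rw [← norm_ne_zero_iff, ← integralOn_eq_norm_restr _ hi0]
    exact hcon.1
  set a := ‖restr hA (h i)‖⁻¹ • restr hA (h i) with ha'
  set b := ‖restr hA.compl (h i)‖⁻¹ • restr hA.compl (h i) with hb'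
  have hainv : P.IsInvariantDensity a :=
    ⟨inv_norm_smul_mem_densities (restr_nonneg _ hi0) ha, by
      rw [ha', map_smul, map_restr_of_absorbing habs hi0 hPi]⟩
  have hbinv : P.IsInvariantDensity b :=
    ⟨inv_norm_smul_mem_densities (restr_nonneg _ hi0) hb, by
      rw [hb', map_smul, map_restr_compl_of_absorbing habs hi0 hPi]⟩
  have hax : ∀ᵐ x ∂m, (h i x = 0 → a x = 0) ∧ (x ∉ A → a x = 0) := by
    filter_upwards [Lp.coeFn_smul ‖restr hA (h i)‖⁻¹ (restr hA (h i)), coeFn_restr hA (h i)]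
      with x h1 h2
    rw [ha', h1, Pi.smul_apply, h2]
    by_cases hx : x ∈ A <;> simp +contextual [hx]
  have hbx : ∀ᵐ x ∂m, (h i x = 0 → b x = 0) ∧ (x ∈ A → b x = 0) := by
    filter_upwards [Lp.coeFn_smul ‖restr hA.compl (h i)‖⁻¹ (restr hA.compl (h i)),
      coeFn_restr hA.compl (h i)] with x h1 h2
    rw [hb', h1, Pi.smul_apply, h2]
    by_cases hx : x ∈ A <;> simp +contextual [hx]
  refine hmax _ ((hh.update i hainv (hax.mono fun x hx => hx.1)).cons hbinv fun j => ?_)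
  rw [measure_supp_inter_eq_zero_iff]
  rcases eq_or_ne j i with rfl | hj
  · rw [Function.update_self]
    filter_upwards [hax, hbx] with x h1 h2
    by_cases hx : x ∈ A
    · exact Or.inl (h2.2 hx)
    · exact Or.inr (h1.2 hx)
  · rw [Function.update_of_ne hj]
    filter_upwards [hbx, measure_supp_inter_eq_zero_iff.1 (hh.2 i j hj.symm)] with x h1 h2
    exact h2.imp_left h1.1

/-- An ergodic density is, up to a factor, the only positive invariant function on its support. -/
theorem IsErgodicDensity.eq_norm_smul {h f : Lp ℝ 1 m} (hh : P.IsErgodicDensity h) (hf : 0 ≤ f)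
    (hPf : P.toLinearMap f = f) (hr : ∀ᵐ x ∂m, h x = 0 → f x = 0) : f = ‖f‖ • h := by
  obtain ⟨⟨⟨h0, h1⟩, hPh⟩, herg⟩ := hh
  have hc0 : (0 : Lp ℝ 1 m) ≤ ‖f‖ • h := smul_nonneg (norm_nonneg f) h0
  have hcn : ‖‖f‖ • h‖ = ‖f‖ := by rw [Lp.norm_smul_of_nonneg (norm_nonneg f), h1, mul_one]
  set u : Lp ℝ 1 m := (f - ‖f‖ • h) ⊔ 0 with hu
  have hPu : P.toLinearMap u = u :=
    P.map_sup_zero_of_map_eq (by rw [map_sub, map_smul, hPf, hPh])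
  have hux : ∀ᵐ x ∂m, u x = (f x - (‖f‖ • h : Lp ℝ 1 m) x) ⊔ 0 := by
    filter_upwards [Lp.coeFn_sup (f - ‖f‖ • h) 0, Lp.coeFn_sub f (‖f‖ • h), Lp.coeFn_zero ℝ 1 m]
      with x e1 e2 e3
    rw [hu, e1, Pi.sup_apply, e2, e3]
    rfl
  have hcx := Lp.coeFn_smul ‖f‖ h
  have hA := measurableSet_supp u
  have hcase := herg (supp u) hA (absorbing_supp le_sup_right hPu)
  rw [← integralOn_apply hA] at hcase
  rcases hcase with hz | ho
  · -- `h`, hence `f`, vanishes where `f > ‖f‖ h`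
    refine Lp.eq_of_le_of_norm_le hf ?_ hcn.le
    have hz' : restr hA h = 0 := by rwa [← norm_eq_zero, ← integralOn_eq_norm_restr hA h0]
    rw [← Lp.coeFn_le]
    filter_upwards [coeFn_restr hA h, Lp.coeFn_zero ℝ 1 m, hux, hcx, hr] with x e1 e2 e3 e4 e5
    by_contra hlt
    have hlt := not_le.1 hlt
    have hxu : x ∈ supp u := by
      change u x ≠ 0
      rw [e3, sup_eq_left.2 (sub_pos.2 hlt).le]
      exact (sub_pos.2 hlt).ne'
    rw [hz', e2, indicator_of_mem hxu] at e1
    have hhx : h x = 0 := e1.symm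
    rw [e4, Pi.smul_apply, hhx, e5 hhx, smul_zero] at hlt
    exact lt_irrefl _ hlt
  · -- `f > ‖f‖ h` on the whole support of `h`
    refine (Lp.eq_of_le_of_norm_le hc0 ?_ hcn.ge).symm
    have ho' : restr hA h = h := restr_eq_self_of_norm_le hA h0 (by rw [ho, h1])
    rw [← Lp.coeFn_le]
    filter_upwards [(restr_eq_self_iff hA).1 ho', hux, hcx, (Lp.coeFn_nonneg _).2 hf]
      with x e1 e2 e3 e4
    by_cases hxu : x ∈ supp u
    · by_contra hlt
      have hlt := not_le.1 hlt
      refine hxu ?_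
      rw [e2, sup_eq_right.2 (sub_neg.2 hlt).le]
    · rw [e3, Pi.smul_apply, e1 hxu, smul_zero]
      exact e4

/-- The positive invariant functions carried by the supports of ergodic densities with disjoint
supports are combinations of these densities. -/
theorem mem_span_of_map_eq (hh : ∀ i, P.IsErgodicDensity (h i))
    (hd : ∀ i j, i ≠ j → m (supp (h i) ∩ supp (h j)) = 0) {f : Lp ℝ 1 m} (hf : 0 ≤ f)
    (hPf : P.toLinearMap f = f) (hr : ∀ᵐ x ∂m, (∀ i, h i x = 0) → f x = 0) :
    f ∈ Submodule.span ℝ (range h) := by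
  have hS := fun i => measurableSet_supp (h i)
  have hsum : f = ∑ i, restr (hS i) f := by
    refine Lp.ext ?_
    have hd' : ∀ᵐ x ∂m, ∀ i j, i ≠ j → h i x = 0 ∨ h j x = 0 := by
      refine ae_all_iff.2 fun i => ae_all_iff.2 fun j => ?_
      by_cases hij : i = j
      · exact ae_of_all _ fun x hne => absurd hij hne
      · filter_upwards [measure_supp_inter_eq_zero_iff.1 (hd i j hij)] with x hx _
        exact hx
    filter_upwards [Lp.coeFn_finsetSum Finset.univ fun i => restr (hS i) f, hd', hr,
      ae_all_iff.2 fun i => coeFn_restr (hS i) f] with x e1 e2 e3 e4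
    rw [e1, Finset.sum_congr rfl fun i _ => e4 i]
    by_cases hx : ∀ i, h i x = 0
    · rw [e3 hx, Finset.sum_eq_zero]
      intro i _
      exact indicator_of_notMem (show x ∉ supp (h i) from fun hi => hi (hx i)) _
    · obtain ⟨i, hi⟩ := not_forall.1 hx
      rw [Finset.sum_eq_single i, indicator_of_mem (show x ∈ supp (h i) from hi)]
      · intro j _ hji
        exact indicator_of_notMem
          (show x ∉ supp (h j) from fun hj => (e2 i j hji.symm).elim hi hj) _
      · exact fun hi => absurd (Finset.mem_univ i) hi
  rw [hsum]
  refine Submodule.sum_mem _ fun i _ => ?_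
  have h1 : P.toLinearMap (restr (hS i) f) = restr (hS i) f :=
    map_restr_of_absorbing (absorbing_supp (hh i).1.1.1 (hh i).1.2) hf hPf
  rw [(hh i).eq_norm_smul (restr_nonneg _ hf) h1 ?_]
  · exact Submodule.smul_mem _ _ (Submodule.subset_span ⟨i, rfl⟩)
  · filter_upwards [(restr_eq_self_iff (hS i)).1 (restr_restr (hS i) f)] with x e1 e2
    exact e1 fun h' => h' e2

end Families

/-! ### From asymptotic mean constrictivity to finitely many ergodic densities -/

section ErgodicDecomposition

variable {X : Type*} [MeasurableSpace X] {m : Measure X} [IsProbabilityMeasure m]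
  {P : MarkovOperator m}

/-- A maximal family of disjoint invariant densities exists because each of them has support of
measure at least `δ`. If it did not attract all mass, the averages of a suitable density would keep
mass `κ` off its support, and their truncated limit would be a further invariant density. -/
theorem fed_of_amc2 (hP : P.AMC2) : P.FED := by
  obtain ⟨κ, hκ, δ, hδ, hsmall⟩ := hP
  have hsmall' : ∀ φ ∈ densities m, ∀ (E : Set X) (hE : MeasurableSet E), m.real E < δ →
      limsup (fun n => integralOn hE (P.avg n φ)) atTop < κ := fun φ hφ E hE h => by
    simpa only [integralOn_apply] using hsmall φ hφ E hE h
  -- invariant densities have large support, so that there are only finitely many disjoint ones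
  have hsupp : ∀ f, P.IsInvariantDensity f → δ ≤ m.real (supp f) := by
    intro f hf
    by_contra! hlt
    have h1 := hsmall' f hf.1 _ (measurableSet_supp f) hlt
    have h2 : (fun n => integralOn (measurableSet_supp f) (P.avg n f)) =ᶠ[atTop] fun _ => 1 := by
      filter_upwards [eventually_ge_atTop 1] with n hn
      rw [P.avg_of_map_eq hf.2 hn, integralOn_of_restr_eq_self _ hf.1.1 (restr_supp_self f),
        hf.1.2]
    rw [limsup_congr h2, limsup_const] at h1
    linarith
  let s : Set ℕ := {r | ∃ h : Fin r → Lp ℝ 1 m, P.IsDisjointInvariantFamily h}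
  have hs0 : s.Nonempty := ⟨0, Fin.elim0, fun i => i.elim0, fun i => i.elim0⟩
  have hsb : BddAbove s := by
    refine ⟨⌊1 / δ⌋₊, ?_⟩
    rintro r ⟨h, hh⟩
    rw [Nat.le_floor_iff (by positivity), le_div_iff₀ hδ]
    exact hh.card_mul_le hsupp
  obtain ⟨r, ⟨h, hh⟩, hmax⟩ : ∃ r ∈ s, ∀ r' ∈ s, r' ≤ r :=
    ⟨sSup s, Nat.sSup_mem hs0 hsb, fun r' hr' => le_csSup hsb hr'⟩
  have hmax' : ∀ h' : Fin (r + 1) → Lp ℝ 1 m, ¬P.IsDisjointInvariantFamily h' := fun h' hh' =>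
    absurd (hmax _ ⟨h', hh'⟩) (by omega)
  set f : Lp ℝ 1 m := (r : ℝ)⁻¹ • ∑ i, h i with hf
  have hPf : P.toLinearMap f = f := map_inv_smul_sum fun i => (hh.1 i).2
  have hf0 : 0 ≤ f := inv_smul_sum_nonneg fun i => (hh.1 i).1.1
  have hS := measurableSet_supp f
  have habs := absorbing_supp hf0 hPf
  have hlim : Tendsto (fun n => integralOn hS.compl ((P.toLinearMap ^ n) (oneLp m))) atTop
      (𝓝 0) := by
    by_contra hcon
    obtain ⟨φ, hφ, hmass⟩ := exists_density_le_integralOn_compl_pow habs hκ oneLp_nonneg hcon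
    obtain ⟨g, hPg, hg, hpos⟩ := exists_invariant_of_le_integralOn_avg hδ hφ.1 (hsmall' φ hφ)
      hS.compl fun n hn => by
        rw [apply_avg, ← inv_mul_sum_const hn κ]
        gcongr
        exact hmass _
    obtain ⟨b, hb, hbS⟩ := exists_invariantDensity_compl habs hPg hg hpos
    refine hmax' _ (hh.cons hb fun i => ?_)
    rw [measure_supp_inter_eq_zero_iff]
    filter_upwards [hbS, ae_inv_smul_sum_eq_zero_iff fun i => (hh.1 i).1.1] with x h1 h2
    by_cases hx : f x = 0
    · exact Or.inr (h2.1 hx i)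
    · exact Or.inl (h1 hx)
  have hlim' : Tendsto (fun n => integralOn hS ((P.toLinearMap ^ n) (oneLp m))) atTop (𝓝 1) := by
    have := (tendsto_const_nhds (x := (1 : ℝ))).sub hlim
    rw [sub_zero] at this
    refine this.congr fun n => ?_
    have h1 := norm_eq_integralOn_add_compl hS (P.pow_nonneg oneLp_nonneg n)
    rw [P.norm_pow_of_nonneg oneLp_nonneg, oneLp_mem_densities.2] at h1
    linarith
  refine ⟨r, h, ?_, fun i => hh.isErgodicDensity hmax' i, hh.2,
    ae_tendsto_adjoint_pow_ind habs hlim'⟩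
  -- `r = 0` would mean that the empty set receives all the mass
  rw [Nat.one_le_iff_ne_zero]
  rintro rfl
  refine zero_ne_one (tendsto_nhds_unique ?_ hlim')
  refine tendsto_const_nhds.congr fun n => ?_
  have hz : f = 0 := by rw [hf]; simp
  rw [integralOn_apply, eq_comm]
  refine setIntegral_measure_zero _ ?_
  rw [measure_eq_zero_iff_ae_notMem, hz]
  filter_upwards [Lp.coeFn_zero ℝ 1 m] with x hx h'
  exact h' hx

end ErgodicDecomposition

end MarkovOperator

/-! ### From finitely many ergodic densities to asymptotic periodicity in mean -/

namespace MarkovOperator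

section AsymptoticPeriodicity

variable {X : Type*} [MeasurableSpace X] {m : Measure X}

/-- The functions whose averages converge in norm to an element of `M`. -/
def meanConvergent (P : MarkovOperator m) (M : Submodule ℝ (Lp ℝ 1 m)) :
    Submodule ℝ (Lp ℝ 1 m) where
  carrier := {φ | ∃ ψ ∈ M, Tendsto (fun n => P.avg n φ) atTop (𝓝 ψ)}
  add_mem' := by
    rintro φ₁ φ₂ ⟨ψ₁, h₁, l₁⟩ ⟨ψ₂, h₂, l₂⟩
    exact ⟨ψ₁ + ψ₂, M.add_mem h₁ h₂, by simpa using l₁.add l₂⟩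
  zero_mem' := ⟨0, M.zero_mem, by simp⟩
  smul_mem' := by
    rintro c φ ⟨ψ, h, l⟩
    exact ⟨c • ψ, M.smul_mem c h, by simpa using l.const_smul c⟩

variable {P : MarkovOperator m} {M : Submodule ℝ (Lp ℝ 1 m)}

theorem mem_meanConvergent {φ : Lp ℝ 1 m} :
    φ ∈ P.meanConvergent M ↔ ∃ ψ ∈ M, Tendsto (fun n => P.avg n φ) atTop (𝓝 ψ) := Iff.rfl

theorem isClosed_meanConvergent (hM : IsClosed (M : Set (Lp ℝ 1 m))) :
    IsClosed (P.meanConvergent M : Set (Lp ℝ 1 m)) := by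
  refine isClosed_of_closure_subset fun φ hφ => ?_
  rw [Metric.mem_closure_iff] at hφ
  have hcau : CauchySeq fun n => P.avg n φ := by
    rw [Metric.cauchySeq_iff']
    intro ε hε
    obtain ⟨φ', ⟨ψ', -, hlim⟩, hd⟩ := hφ (ε / 3) (by positivity)
    obtain ⟨N, hN⟩ := Metric.cauchySeq_iff'.1 hlim.cauchySeq (ε / 3) (by positivity)
    refine ⟨N, fun n hn => ?_⟩
    have h1 : ∀ n, dist (P.avg n φ) (P.avg n φ') < ε / 3 := fun n => by
      rw [dist_eq_norm, ← map_sub]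
      rw [dist_eq_norm] at hd
      exact (P.norm_avg_le _ n).trans_lt hd
    have h2 := h1 N
    rw [dist_comm] at h2
    linarith [dist_triangle4 (P.avg n φ) (P.avg n φ') (P.avg N φ') (P.avg N φ), h1 n, hN n hn]
  obtain ⟨ψ, hψ⟩ := cauchySeq_tendsto_of_complete hcau
  refine ⟨ψ, ?_, hψ⟩
  rw [← SetLike.mem_coe, ← hM.closure_eq, Metric.mem_closure_iff]
  intro ε hε
  obtain ⟨φ', ⟨ψ', hψ', hlim⟩, hd⟩ := hφ (ε / 2) (by positivity)
  refine ⟨ψ', hψ', lt_of_le_of_lt ?_ (half_lt_self hε)⟩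
  refine le_of_tendsto (hψ.dist hlim) (Eventually.of_forall fun n => ?_)
  rw [dist_eq_norm, ← map_sub]
  rw [dist_eq_norm] at hd
  exact (P.norm_avg_le _ n).trans hd.le

theorem sub_pow_mem_meanConvergent (φ : Lp ℝ 1 m) (N : ℕ) :
    φ - (P.toLinearMap ^ N) φ ∈ P.meanConvergent M := by
  induction N with
  | zero => simp
  | succ N ih =>
    have h1 : (P.toLinearMap ^ N) φ - P.toLinearMap ((P.toLinearMap ^ N) φ) ∈
        P.meanConvergent M := ⟨0, M.zero_mem, P.tendsto_avg_sub_map _⟩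
    have := Submodule.add_mem _ ih h1
    rwa [sub_add_sub_cancel, ← pow_succ_apply] at this

variable [IsProbabilityMeasure m] {r : ℕ} {h : Fin r → Lp ℝ 1 m}

/-- Finitely many ergodic densities with disjoint supports that attract all mass attract all
averages in norm. -/
theorem meanConvergent_span_eq_top (hh : ∀ i, P.IsErgodicDensity (h i))
    (hd : ∀ i j, i ≠ j → m (supp (h i) ∩ supp (h j)) = 0)
    (hmax : P.HasMaximalSupport ((r : ℝ)⁻¹ • ∑ i, h i)) (φ : Lp ℝ 1 m) :
    φ ∈ P.meanConvergent (Submodule.span ℝ (range h)) := by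
  set M := Submodule.span ℝ (range h) with hM
  have hMfin : FiniteDimensional ℝ M := FiniteDimensional.span_of_finite ℝ (finite_range h)
  have hclosed : IsClosed (P.meanConvergent M : Set (Lp ℝ 1 m)) :=
    isClosed_meanConvergent (Submodule.closed_of_finiteDimensional M)
  set f : Lp ℝ 1 m := (r : ℝ)⁻¹ • ∑ i, h i with hf
  have hPf : P.toLinearMap f = f := map_inv_smul_sum fun i => (hh i).1.2
  have hf0 : 0 ≤ f := inv_smul_sum_nonneg fun i => (hh i).1.1.1
  have hfx := ae_inv_smul_sum_eq_zero_iff fun i => (hh i).1.1.1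
  have hS := measurableSet_supp f
  have hdom : ∀ (k : ℕ) (φ : Lp ℝ 1 m), 0 ≤ φ → φ ≤ (k : ℝ) • f → φ ∈ P.meanConvergent M := by
    intro k φ hφ hle
    obtain ⟨ψ, h0, h1, h2, h3⟩ := P.exists_tendsto_avg_of_le hφ hle (by rw [map_smul, hPf])
    refine ⟨ψ, mem_span_of_map_eq hh hd h0 h2 ?_, h3⟩
    filter_upwards [hfx, (Lp.coeFn_nonneg _).2 h0, (Lp.coeFn_le _ _).2 h1,
      Lp.coeFn_smul (k : ℝ) f] with x e1 e2 e3 e4 e5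
    refine le_antisymm (e3.trans_eq ?_) e2
    rw [e4, Pi.smul_apply, e1.2 e5, smul_zero]
  have hcarried : ∀ φ : Lp ℝ 1 m, 0 ≤ φ → restr hS φ = φ → φ ∈ P.meanConvergent M := by
    intro φ hφ hr
    have hlim := Lp.tendsto_inf_nat_smul hφ hf0 (by
      filter_upwards [(restr_eq_self_iff hS).1 hr] with x hx h'
      exact hx fun h'' => h'' h')
    exact hclosed.mem_of_tendsto hlim (Eventually.of_forall fun k =>
      hdom k _ (le_inf hφ (smul_nonneg k.cast_nonneg hf0)) inf_le_right)
  have hpos : ∀ φ : Lp ℝ 1 m, 0 ≤ φ → φ ∈ P.meanConvergent M := by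
    intro φ hφ
    rw [← SetLike.mem_coe, ← hclosed.closure_eq, Metric.mem_closure_iff]
    intro ε hε
    obtain ⟨N, hN⟩ := ((tendsto_integralOn_compl_pow hmax hφ).eventually
      (gt_mem_nhds hε)).exists
    have hN0 := P.pow_nonneg hφ N
    -- the averages do not see the difference of `φ` and `P^N φ`
    refine ⟨φ - (P.toLinearMap ^ N) φ + restr hS ((P.toLinearMap ^ N) φ),
      Submodule.add_mem _ (sub_pow_mem_meanConvergent φ N)
        (hcarried _ (restr_nonneg hS hN0) (restr_restr hS _)), ?_⟩
    have e : φ - (φ - (P.toLinearMap ^ N) φ + restr hS ((P.toLinearMap ^ N) φ)) =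
        restr hS.compl ((P.toLinearMap ^ N) φ) := by
      rw [eq_sub_of_add_eq' (restr_add_restr_compl hS ((P.toLinearMap ^ N) φ))]
      abel
    rw [dist_eq_norm, e, ← integralOn_eq_norm_restr _ hN0]
    exact hN
  have hsplit : φ = φ ⊔ 0 - (-φ) ⊔ 0 := (posPart_sub_negPart φ).symm
  rw [hsplit]
  exact Submodule.sub_mem _ (hpos _ le_sup_right) (hpos _ le_sup_right)

theorem integralOn_supp_of_disjoint (h0 : ∀ i, h i ∈ densities m)
    (hd : ∀ i j, i ≠ j → m (supp (h i) ∩ supp (h j)) = 0) (i j : Fin r) :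
    integralOn (measurableSet_supp (h i)) (h j) = if i = j then 1 else 0 := by
  split_ifs with hij
  · subst hij
    rw [integralOn_of_restr_eq_self _ (h0 i).1 (restr_supp_self _), (h0 i).2]
  · rw [integralOn_apply]
    refine setIntegral_eq_zero_of_ae_eq_zero ?_
    filter_upwards [measure_supp_inter_eq_zero_iff.1 (hd i j hij)] with x hx hxi
    exact hx.resolve_left hxi

/-- The functional `λ_i` is the mass that the limit of the averages puts on `supp h_i`. -/
theorem apm_of_fed (hP : P.FED) : P.APM := by
  obtain ⟨r, h, hr, hh, hd, hmax⟩ := hP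
  have hconv := meanConvergent_span_eq_top hh hd hmax
  simp only [mem_meanConvergent] at hconv
  choose Q hQM hQ using hconv
  let L : Lp ℝ 1 m →ₗ[ℝ] Lp ℝ 1 m := linearMapOfTendsto Q P.avg (tendsto_pi_nhds.2 hQ)
  let T : Lp ℝ 1 m →L[ℝ] Lp ℝ 1 m := L.mkContinuous 1 fun φ => by
    rw [one_mul]
    exact le_of_tendsto' (hQ φ).norm fun n => P.norm_avg_le φ n
  refine ⟨r, h, fun i => (integralOn (measurableSet_supp (h i))).comp T, hr, hh, hd,
    fun i φ hφ => integralOn_nonneg _ (ge_of_tendsto' (hQ φ) (P.avg_nonneg hφ)), fun φ => ?_⟩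
  have hsum : ∑ i, (integralOn (measurableSet_supp (h i)) (Q φ)) • h i = Q φ := by
    obtain ⟨c, hc⟩ := (Submodule.mem_span_range_iff_exists_fun ℝ).1 (hQM φ)
    have : ∀ i, integralOn (measurableSet_supp (h i)) (Q φ) = c i := fun i => by
      rw [← hc, map_sum]
      simp [integralOn_supp_of_disjoint (fun i => (hh i).1.1) hd]
    rw [Finset.sum_congr rfl fun i _ => by rw [this i], hc]
  have := tendsto_iff_norm_sub_tendsto_zero.1 (hQ φ)
  rw [← hsum] at this
  exact this

end AsymptoticPeriodicity

end MarkovOperator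

/-! ### Weakly compact sets of `L¹(m)` are uniformly integrable -/

/-- If the sums over every subset of `ℕ` of the sequences `a i` tend to `0` as `i → ∞`, then so do
their terms, uniformly off a finite set. This is the category argument behind Schur's theorem on
`ℓ¹`, applied to the compact space of all subsets of `ℕ`. -/
theorem exists_eventually_cofinite_abs_le {a : ℕ → ℕ → ℝ} (ha : ∀ i, Summable (a i))
    (hlim : ∀ σ : ℕ → Bool, Tendsto (fun i => ∑' n, if σ n then a i n else 0) atTop (𝓝 0))
    {ε : ℝ} (hε : 0 < ε) : ∃ k, ∀ᶠ n in cofinite, ∀ i ≥ k, |a i n| ≤ ε := by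
  have hle : ∀ i (σ : ℕ → Bool) n, ‖if σ n then a i n else 0‖ ≤ |a i n| := fun i σ n => by
    split_ifs <;> simp
  have hsum : ∀ i (σ : ℕ → Bool), Summable fun n => if σ n then a i n else 0 := fun i σ =>
    Summable.of_norm_bounded (ha i).abs (hle i σ)
  have hcont : ∀ i, Continuous fun σ : ℕ → Bool => ∑' n, if σ n then a i n else 0 := fun i =>
    continuous_tsum (fun n => (continuous_of_discreteTopology
      (f := fun b : Bool => if b then a i n else 0)).comp (continuous_apply n)) (ha i).abs
      fun n σ => hle i σ n
  let D : ℕ → Set (ℕ → Bool) := fun k =>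
    ⋂ i ≥ k, {σ | |∑' n, if σ n then a i n else 0| ≤ ε / 2}
  have hD : ∀ k, IsClosed (D k) := fun k => isClosed_biInter fun i _ =>
    isClosed_le (hcont i).abs continuous_const
  have hU : ⋃ k, D k = univ := by
    refine eq_univ_of_forall fun σ => ?_
    obtain ⟨k, hk⟩ := eventually_atTop.1 (Metric.tendsto_nhds.1 (hlim σ) (ε / 2) (by positivity))
    refine mem_iUnion.2 ⟨k, mem_iInter₂.2 fun i hi => ?_⟩
    have := hk i hi
    rw [Real.dist_eq, sub_zero] at this
    exact this.le
  obtain ⟨k, σ₀, hσ₀⟩ := nonempty_interior_of_iUnion_of_closed hD hU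
  obtain ⟨I, u, hu, hI⟩ := isOpen_pi_iff.1 isOpen_interior σ₀ hσ₀
  refine ⟨k, ?_⟩
  filter_upwards [I.finite_toSet.compl_mem_cofinite] with n hn i hi
  -- changing the coordinate `n ∉ I` of `σ₀` does not lead out of `D k`
  have hmem : ∀ b, |∑' j, if Function.update σ₀ n b j then a i j else 0| ≤ ε / 2 := fun b => by
    refine mem_iInter₂.1 (interior_subset (hI ?_) : Function.update σ₀ n b ∈ D k) i hi
    intro j hj
    have hjn : j ≠ n := fun h => hn (h ▸ hj)
    rw [Function.update_of_ne hjn]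
    exact (hu j hj).2
  have hdiff : (∑' j, if Function.update σ₀ n true j then a i j else 0) -
      (∑' j, if Function.update σ₀ n false j then a i j else 0) = a i n := by
    rw [← (hsum i _).tsum_sub (hsum i _), tsum_eq_single n]
    · simp
    · intro j hj
      simp [Function.update_of_ne hj]
  rw [← hdiff]
  have h1 := abs_le.1 (hmem true)
  have h2 := abs_le.1 (hmem false)
  rw [abs_le]
  constructor <;> linarith [h1.1, h1.2, h2.1, h2.2]

namespace MarkovOperator

section UniformIntegrability

variable {X : Type*} [MeasurableSpace X] {m : Measure X}

theorem IsWeaklyCompact.exists_weak_limit {F : Set (Lp ℝ 1 m)} (hF : IsWeaklyCompact F)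
    {f : ℕ → Lp ℝ 1 m} (hf : ∀ n, f n ∈ F) (U : Ultrafilter ℕ) :
    ∃ g ∈ F, ∀ l : Lp ℝ 1 m →L[ℝ] ℝ, Tendsto (fun n => l (f n)) U (𝓝 (l g)) := by
  obtain ⟨y, ⟨g, hg, rfl⟩, hy⟩ := hF.ultrafilter_le_nhds
    (U.map fun n => toWeakSpace ℝ (Lp ℝ 1 m) (f n)) (by
      rw [le_principal_iff, Ultrafilter.mem_coe, Ultrafilter.mem_map]
      exact univ_mem' fun n => ⟨f n, hf n, rfl⟩)
  refine ⟨g, hg, fun l => ?_⟩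
  have h1 : Tendsto (fun n => toWeakSpace ℝ (Lp ℝ 1 m) (f n)) U
      (𝓝 (toWeakSpace ℝ (Lp ℝ 1 m) g)) := hy
  exact ((WeakBilin.eval_continuous (topDualPairing ℝ (Lp ℝ 1 m)).flip l).tendsto _).comp h1

variable [IsProbabilityMeasure m]

/-- Absolute continuity of the integral of a single function. -/
theorem exists_abs_integralOn_lt (g : Lp ℝ 1 m) {ε : ℝ} (hε : 0 < ε) :
    ∃ δ > 0, ∀ (E : Set X) (hE : MeasurableSet E), m.real E < δ → |integralOn hE g| < ε := by
  have hlim := tendsto_iff_norm_sub_tendsto_zero.1 (tendsto_inf_nat_smul_oneLp (abs_nonneg g))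
  obtain ⟨k, hk⟩ := (hlim.eventually (gt_mem_nhds (half_pos hε))).exists
  refine ⟨ε / 2 / (k + 1), by positivity, fun E hE hlt => ?_⟩
  have h1 : |integralOn hE g| ≤ integralOn hE |g| := by
    rw [abs_le]
    have e1 := integralOn_mono hE (le_abs_self g)
    have e2 := integralOn_mono hE (neg_le_abs g)
    rw [map_neg] at e2
    constructor <;> linarith
  have h2 : integralOn hE |g| - integralOn hE (|g| ⊓ (k : ℝ) • oneLp m) ≤
      ‖|g| ⊓ (k : ℝ) • oneLp m - |g|‖ := by
    rw [← map_sub, norm_sub_rev]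
    exact (le_abs_self _).trans (abs_integralOn_le hE _)
  have h3 : integralOn hE (|g| ⊓ (k : ℝ) • oneLp m) ≤ k * m.real E := by
    refine (integralOn_mono hE inf_le_right).trans_eq ?_
    rw [map_smul, smul_eq_mul, integralOn_apply, setIntegral_congr_ae (g := fun _ => (1 : ℝ)) hE
      ((coeFn_oneLp (m := m)).mono fun x hx _ => hx)]
    simp
  have h4 : k * m.real E ≤ ε / 2 := by
    rw [lt_div_iff₀ (by positivity)] at hlt
    nlinarith [measureReal_nonneg (μ := m) (s := E)]
  linarith

theorem hasSum_integralOn_iUnion {B : ℕ → Set X} (hB : ∀ n, MeasurableSet (B n))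
    (hd : Pairwise fun i j => Disjoint (B i) (B j)) (g : Lp ℝ 1 m) :
    HasSum (fun n => integralOn (hB n) g) (integralOn (MeasurableSet.iUnion hB) g) := by
  simp_rw [integralOn_apply]
  exact hasSum_integral_iUnion hB hd (L1.integrable_coeFn g).integrableOn

/-- Members of a weakly compact set cannot keep mass on disjoint sets. -/
theorem IsWeaklyCompact.not_forall_le_abs_integralOn {F : Set (Lp ℝ 1 m)}
    (hF : IsWeaklyCompact F) {f : ℕ → Lp ℝ 1 m} (hf : ∀ n, f n ∈ F) {B : ℕ → Set X}
    (hB : ∀ n, MeasurableSet (B n)) (hd : Pairwise fun i j => Disjoint (B i) (B j))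
    {ε : ℝ} (hε : 0 < ε) :
    ¬∀ n, ε ≤ |integralOn (hB n) (f n)| := by
  intro hcon
  -- a subsequence along which the masses on all `B n` converge
  obtain ⟨g, -, ψ, hψ, hlim⟩ : ∃ g ∈ F, ∃ ψ : ℕ → ℕ, StrictMono ψ ∧
      ∀ n, Tendsto (fun i => integralOn (hB n) (f (ψ i))) atTop (𝓝 (integralOn (hB n) g)) := by
    let Φ : WeakSpace ℝ (Lp ℝ 1 m) → ℕ → ℝ := fun y n =>
      integralOn (hB n) ((toWeakSpace ℝ (Lp ℝ 1 m)).symm y)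
    have hΦ : Continuous Φ := continuous_pi fun n =>
      WeakBilin.eval_continuous (topDualPairing ℝ (Lp ℝ 1 m)).flip (integralOn (hB n))
    obtain ⟨_, ⟨_, ⟨g, hg, rfl⟩, rfl⟩, ψ, hψ, hlim⟩ := (hF.image hΦ).tendsto_subseq
      (x := fun n => Φ (toWeakSpace ℝ (Lp ℝ 1 m) (f n)))
      fun n => mem_image_of_mem _ (mem_image_of_mem _ (hf n))
    exact ⟨g, hg, ψ, hψ, fun n => tendsto_pi_nhds.1 hlim n⟩
  have hC : ∀ (σ : ℕ → Bool) n, MeasurableSet (if σ n then B n else ∅) := fun σ n => by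
    split_ifs
    · exact hB n
    · exact MeasurableSet.empty
  have hCd : ∀ σ : ℕ → Bool, Pairwise fun i j =>
      Disjoint (if σ i then B i else ∅) (if σ j then B j else ∅) := fun σ i j hij => by
    refine (hd hij).mono ?_ ?_ <;> split_ifs <;> simp
  have hCsum : ∀ (σ : ℕ → Bool) (u : Lp ℝ 1 m), integralOn (MeasurableSet.iUnion (hC σ)) u =
      ∑' n, if σ n then integralOn (hB n) u else 0 := fun σ u => by
    rw [← (hasSum_integralOn_iUnion (hC σ) (hCd σ) u).tsum_eq]
    refine tsum_congr fun n => ?_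
    simp only [integralOn_apply]
    split_ifs <;> simp
  -- then the masses on all unions of the `B n` converge as well, since these are determined by the
  -- masses on the `B n` and since the weak cluster points exist
  have hlimσ : ∀ σ : ℕ → Bool, Tendsto
      (fun i => ∑' n, if σ n then integralOn (hB n) (f (ψ i) - g) else 0) atTop (𝓝 0) := by
    intro σ
    simp_rw [← hCsum]
    rw [tendsto_iff_ultrafilter]
    intro U hU
    obtain ⟨g', -, hg'⟩ := hF.exists_weak_limit (f := fun i => f (ψ i)) (fun i => hf _) U
    have heq : ∀ n, integralOn (hB n) g' = integralOn (hB n) g := fun n =>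
      tendsto_nhds_unique (hg' _) ((hlim n).mono_left hU)
    have h1 := (hg' (integralOn (MeasurableSet.iUnion (hC σ)))).sub_const
      (integralOn (MeasurableSet.iUnion (hC σ)) g)
    rw [hCsum σ g', hCsum σ g] at h1
    simp_rw [heq, sub_self] at h1
    refine h1.congr fun i => ?_
    rw [map_sub, hCsum σ g]
  obtain ⟨k, hk⟩ := exists_eventually_cofinite_abs_le
    (a := fun i n => integralOn (hB n) (f (ψ i) - g))
    (fun i => (hasSum_integralOn_iUnion hB hd _).summable) hlimσ (by positivity : 0 < ε / 4)
  rw [Nat.cofinite_eq_atTop] at hk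
  have hg0 : Tendsto (fun n => integralOn (hB n) g) atTop (𝓝 0) :=
    (hasSum_integralOn_iUnion hB hd g).summable.tendsto_atTop_zero
  have hg1 := Metric.tendsto_nhds.1 hg0 (ε / 4) (by positivity)
  obtain ⟨i, hi, h1, h2⟩ := ((eventually_ge_atTop k).and
    ((hψ.tendsto_atTop.eventually hk).and (hψ.tendsto_atTop.eventually hg1))).exists
  have h3 := h1 i hi
  rw [Real.dist_eq, sub_zero] at h2
  rw [map_sub] at h3
  have h4 := abs_sub_abs_le_abs_sub (integralOn (hB (ψ i)) (f (ψ i))) (integralOn (hB (ψ i)) g)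
  linarith [hcon (ψ i)]

/-- **Dunford–Pettis**: weakly compact subsets of `L¹(m)` are uniformly integrable. A sequence of
functions with mass on ever smaller sets yields, after removal from each set of the later ones,
functions with mass on disjoint sets. -/
theorem IsWeaklyCompact.exists_integralOn_lt {F : Set (Lp ℝ 1 m)} (hF : IsWeaklyCompact F)
    {ε : ℝ} (hε : 0 < ε) : ∃ δ > 0, ∀ f ∈ F, ∀ (E : Set X) (hE : MeasurableSet E),
      m.real E < δ → |integralOn hE f| < ε := by
  by_contra! hcon
  choose! f hf E hE hEδ hfE using hcon
  choose d hd0 hd using fun g : Lp ℝ 1 m => exists_abs_integralOn_lt g (half_pos hε)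
  let t : ℕ → ℝ := fun n => Nat.rec 1 (fun _ s => min (s / 2) (d (f s) / 4)) n
  have ht : ∀ n, t (n + 1) = min (t n / 2) (d (f (t n)) / 4) := fun n => rfl
  have ht0 : ∀ n, 0 < t n := fun n => by
    induction n with
    | zero => exact one_pos
    | succ n ih =>
      rw [ht]
      exact lt_min (by positivity) (div_pos (hd0 _) (by norm_num))
  have htj : ∀ n j, t (n + j) ≤ t n / 2 ^ j := fun n j => by
    induction j with
    | zero => simp
    | succ j ih =>
      rw [← add_assoc, ht, pow_succ, ← div_div]
      exact (min_le_left _ _).trans (by gcongr)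
  have hEm : ∀ n, MeasurableSet (E (t n)) := fun n => hE _ (ht0 n)
  have hGm : ∀ n, MeasurableSet (⋃ j, E (t (n + 1 + j))) := fun n =>
    MeasurableSet.iUnion fun j => hEm _
  have hGd : ∀ n, m.real (⋃ j, E (t (n + 1 + j))) < d (f (t n)) := fun n => by
    have h1 : m.real (⋃ j, E (t (n + 1 + j))) ≤ 2 * t (n + 1) := by
      refine ENNReal.toReal_le_of_le_ofReal (by linarith [ht0 (n + 1)]) ?_
      refine (measure_iUnion_le _).trans ?_
      rw [← tsum_geometric_two' (2 * t (n + 1)), ENNReal.ofReal_tsum_of_nonneg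
        (fun k => by have := ht0 (n + 1); positivity) (summable_geometric_two' _)]
      refine ENNReal.tsum_le_tsum fun j => ?_
      rw [← ENNReal.ofReal_toReal (measure_ne_top m (E (t (n + 1 + j))))]
      refine ENNReal.ofReal_le_ofReal ((hEδ _ (ht0 _)).le.trans ((htj _ _).trans_eq ?_))
      ring
    have h2 : t (n + 1) ≤ d (f (t n)) / 4 := min_le_right _ _
    linarith [hd0 (f (t n))]
  let B : ℕ → Set X := fun n => E (t n) \ ⋃ j, E (t (n + 1 + j))
  have hB : ∀ n, MeasurableSet (B n) := fun n => (hEm n).diff (hGm n)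
  have hlt : ∀ i j, i < j → Disjoint (B i) (B j) := fun i j hij => by
    refine disjoint_left.2 fun x hx hx' => hx.2 (mem_iUnion.2 ⟨j - (i + 1), ?_⟩)
    rw [show i + 1 + (j - (i + 1)) = j by omega]
    exact hx'.1
  have hBd : Pairwise fun i j => Disjoint (B i) (B j) := fun i j hij =>
    (lt_or_gt_of_ne hij).elim (hlt i j) fun h => (hlt j i h).symm
  refine hF.not_forall_le_abs_integralOn (fun n => hf (t n) (ht0 n)) hB hBd (half_pos hε)
    fun n => ?_
  have hI := (hEm n).inter (hGm n)
  have hsplit : integralOn (hEm n) (f (t n)) =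
      integralOn hI (f (t n)) + integralOn (hB n) (f (t n)) := by
    simp only [integralOn_apply]
    exact (integral_inter_add_sdiff (hGm n) (L1.integrable_coeFn _).integrableOn).symm
  have h1 := hd (f (t n)) _ hI (lt_of_le_of_lt (measureReal_mono inter_subset_right) (hGd n))
  have h2 := hfE (t n) (ht0 n)
  rw [hsplit] at h2
  linarith [abs_add_le (integralOn hI (f (t n))) (integralOn (hB n) (f (t n)))]

end UniformIntegrability

end MarkovOperator

/-! ### The elementary implications -/

namespace MarkovOperator

section Implications

variable {X : Type*} [MeasurableSpace X] {m : Measure X} {P : MarkovOperator m}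

/-- The averages approach the compact box spanned by the densities `h i`, whose coefficients are
bounded by the norms of the functionals. -/
theorem mc_of_apm [IsProbabilityMeasure m] (hP : P.APM) : P.MC := by
  obtain ⟨r, h, lam, -, -, -, -, hlim⟩ := hP
  let s : Fin r → Set ℝ := fun i => Icc (-‖lam i‖) ‖lam i‖
  let F : Set (Lp ℝ 1 m) := (fun t : Fin r → ℝ => ∑ i, t i • h i) '' univ.pi s
  refine ⟨F, ⟨_, 0, fun i _ => ⟨by simp, by simp⟩, rfl⟩,
    (isCompact_univ_pi fun i => isCompact_Icc).image (by fun_prop), fun φ hφ => ?_⟩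
  refine squeeze_zero (fun n => Metric.infDist_nonneg) (fun n => ?_) (hlim φ)
  rw [← dist_eq_norm]
  refine Metric.infDist_le_dist_of_mem ⟨fun i => lam i φ, fun i _ => ?_, rfl⟩
  have := (lam i).le_opNorm φ
  rw [hφ.2, mul_one, Real.norm_eq_abs] at this
  exact abs_le.1 this

theorem isWeaklyCompact_of_isCompact {F : Set (Lp ℝ 1 m)} (hF : IsCompact F) :
    IsWeaklyCompact F :=
  hF.image (toWeakSpaceCLM ℝ (Lp ℝ 1 m)).continuous

theorem wmc_of_mc (hP : P.MC) : P.WMC := by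
  obtain ⟨F, hne, hF, h⟩ := hP
  exact ⟨F, hne, isWeaklyCompact_of_isCompact hF, h⟩

theorem mc2_of_mc (hP : P.MC) : P.MC2 := by
  obtain ⟨F, hne, hF, h⟩ := hP
  exact ⟨F, hne, hF, 0, one_pos, fun φ hφ => (h φ hφ).limsup_eq.le⟩

theorem wmc2_of_wmc (hP : P.WMC) : P.WMC2 := by
  obtain ⟨F, hne, hF, h⟩ := hP
  exact ⟨F, hne, hF, 0, one_pos, fun φ hφ => (h φ hφ).limsup_eq.le⟩

theorem wmc2_of_mc2 (hP : P.MC2) : P.WMC2 := by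
  obtain ⟨F, hne, hF, h⟩ := hP
  exact ⟨F, hne, isWeaklyCompact_of_isCompact hF, h⟩

theorem isBoundedUnder_infDist_avg {F : Set (Lp ℝ 1 m)} (hne : F.Nonempty) (φ : Lp ℝ 1 m) :
    IsBoundedUnder (· ≤ ·) atTop fun n => Metric.infDist (P.avg n φ) F := by
  obtain ⟨f, hf⟩ := hne
  refine isBoundedUnder_of ⟨‖φ‖ + ‖f‖, fun n => ?_⟩
  refine (Metric.infDist_le_dist_of_mem hf).trans ?_
  rw [dist_eq_norm]
  exact (norm_sub_le _ _).trans (by gcongr; exact P.norm_avg_le φ n)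

theorem mcdp2_of_mcdp (hP : P.MCDP) : P.MCDP2 := by
  obtain ⟨δ, hδ, h⟩ := hP (1 / 2) (by norm_num)
  refine ⟨1 / 2, by norm_num, δ, hδ, fun φ hφ => ?_⟩
  obtain ⟨n₀, h1, h2⟩ := h φ hφ
  exact ⟨n₀, h1, fun n hn E hE hEδ => (h2 n hn E hE hEδ).le⟩

theorem amc2_of_amc (hP : P.AMC) : P.AMC2 := by
  obtain ⟨δ, hδ, h⟩ := hP (1 / 2) (by norm_num)
  exact ⟨1 / 2, by norm_num, δ, hδ, h⟩

variable [IsProbabilityMeasure m]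

theorem limsup_setIntegral_avg_le {E : Set X} (hE : MeasurableSet E) {φ : Lp ℝ 1 m} {c : ℝ}
    {n₀ : ℕ} (h : ∀ n, n₀ ≤ n → ∫ x in E, P.avg n φ x ∂m ≤ c) :
    limsup (fun n : ℕ => ∫ x in E, P.avg n φ x ∂m) atTop ≤ c := by
  refine limsup_le_of_le ?_ (eventually_atTop.2 ⟨n₀, h⟩)
  refine IsBoundedUnder.isCoboundedUnder_le (isBoundedUnder_of ⟨-‖φ‖, fun n => ?_⟩)
  rw [← integralOn_apply hE]
  exact (abs_le.1 ((abs_integralOn_le hE _).trans (P.norm_avg_le φ n))).1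

theorem amc_of_mcdp (hP : P.MCDP) : P.AMC := by
  intro ε hε
  obtain ⟨δ, hδ, h⟩ := hP (ε / 2) (half_pos hε)
  refine ⟨δ, hδ, fun φ hφ E hE hEδ => ?_⟩
  obtain ⟨n₀, -, h2⟩ := h φ hφ
  exact (limsup_setIntegral_avg_le hE fun n hn => (h2 n hn E hE hEδ).le).trans_lt
    (half_lt_self hε)

theorem amc2_of_mcdp2 (hP : P.MCDP2) : P.AMC2 := by
  obtain ⟨κ, hκ, δ, hδ, h⟩ := hP
  obtain ⟨κ', h1, h2⟩ := exists_between hκ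
  refine ⟨κ', h2, δ, hδ, fun φ hφ E hE hEδ => ?_⟩
  obtain ⟨n₀, -, h3⟩ := h φ hφ
  exact (limsup_setIntegral_avg_le hE fun n hn => h3 n hn E hE hEδ).trans_lt h1

/-- Averages that come within distance `c` of a weakly compact set are equi-integrable up to `c`. -/
theorem IsWeaklyCompact.exists_setIntegral_avg_lt {F : Set (Lp ℝ 1 m)} (hF : IsWeaklyCompact F)
    (hne : F.Nonempty) (c : ℝ) {ε : ℝ} (hε : 0 < ε) : ∃ δ > 0, ∀ φ : Lp ℝ 1 m,
      (∀ᶠ n in atTop, Metric.infDist (P.avg n φ) F < c) → ∃ n₀ : ℕ, 1 ≤ n₀ ∧ ∀ n, n₀ ≤ n →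
        ∀ E : Set X, MeasurableSet E → m.real E < δ → ∫ x in E, P.avg n φ x ∂m < c + ε := by
  obtain ⟨δ, hδ, h⟩ := hF.exists_integralOn_lt hε
  refine ⟨δ, hδ, fun φ hφ => ?_⟩
  obtain ⟨N, hN⟩ := eventually_atTop.1 hφ
  refine ⟨max N 1, le_max_right _ _, fun n hn E hE hEδ => ?_⟩
  obtain ⟨f, hf, hd⟩ := (Metric.infDist_lt_iff hne).1 (hN n (le_of_max_le_left hn))
  have h1 := h f hf E hE hEδ
  have h2 := abs_integralOn_le hE (P.avg n φ - f)
  rw [dist_eq_norm] at hd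
  rw [map_sub] at h2
  rw [← integralOn_apply hE]
  linarith [le_abs_self (integralOn hE (P.avg n φ) - integralOn hE f),
    le_abs_self (integralOn hE f)]

theorem mcdp_of_wmc (hP : P.WMC) : P.MCDP := by
  obtain ⟨F, hne, hF, h⟩ := hP
  intro ε hε
  obtain ⟨δ, hδ, hE⟩ := hF.exists_setIntegral_avg_lt (P := P) hne (ε / 2) (half_pos hε)
  refine ⟨δ, hδ, fun φ hφ => ?_⟩
  simpa only [add_halves] using hE φ ((h φ hφ).eventually (gt_mem_nhds (half_pos hε)))

theorem mcdp2_of_wmc2 (hP : P.WMC2) : P.MCDP2 := by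
  obtain ⟨F, hne, hF, κ, hκ, h⟩ := hP
  have hε : 0 < (1 - κ) / 3 := by linarith
  obtain ⟨δ, hδ, hE⟩ := hF.exists_setIntegral_avg_lt (P := P) hne (κ + (1 - κ) / 3) hε
  refine ⟨κ + (1 - κ) / 3 + (1 - κ) / 3, by linarith, δ, hδ, fun φ hφ => ?_⟩
  obtain ⟨n₀, h1, h2⟩ := hE φ (eventually_lt_of_limsup_lt
    ((h φ hφ).trans_lt (by linarith)) (isBoundedUnder_infDist_avg hne φ))
  exact ⟨n₀, h1, fun n hn E hE hEδ => (h2 n hn E hE hEδ).le⟩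

end Implications

end MarkovOperator

theorem theoremD {X : Type*} [MeasurableSpace X] (m : Measure X) [IsProbabilityMeasure m]
    (P : MarkovOperator m) :
    [P.MC, P.MC2, P.WMC, P.WMC2, P.MCDP, P.MCDP2, P.AMC, P.AMC2, P.FED, P.APM].TFAE := by
  tfae_have 1 → 2 := MarkovOperator.mc2_of_mc
  tfae_have 1 → 3 := MarkovOperator.wmc_of_mc
  tfae_have 2 → 4 := MarkovOperator.wmc2_of_mc2
  tfae_have 3 → 4 := MarkovOperator.wmc2_of_wmc
  tfae_have 3 → 5 := MarkovOperator.mcdp_of_wmc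
  tfae_have 4 → 6 := MarkovOperator.mcdp2_of_wmc2
  tfae_have 5 → 6 := MarkovOperator.mcdp2_of_mcdp
  tfae_have 5 → 7 := MarkovOperator.amc_of_mcdp
  tfae_have 6 → 8 := MarkovOperator.amc2_of_mcdp2
  tfae_have 7 → 8 := MarkovOperator.amc2_of_amc
  tfae_have 8 → 9 := MarkovOperator.fed_of_amc2
  tfae_have 9 → 10 := MarkovOperator.apm_of_fed
  tfae_have 10 → 1 := MarkovOperator.mc_of_apm
  tfae_finish
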